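/- **Theorem (asymptotic distribution).** Let $G=\{G_t,\ t\ge 0\}$ be a centered Gaussian process with continuous paths on a probability space, let $\theta>0$, $\mu\in\mathbb{R}$, $\alpha=\theta\mu$, and let $X$ be the continuous pathwise solution of $X_0=0$, $dX_t=\theta(\mu+X_t)\,dt+dG_t$, $t\ge 0$, that is $X_t=\theta\int_0^t(\mu+X_s)\,ds+G_t-G_0$. For $T>0$ put $$\widetilde\theta_T=\frac{\frac12TX_T^2-X_T\int_0^TX_s\,ds}{T\int_0^TX_s^2\,ds-\left(\int_0^TX_s\,ds\right)^2},\qquad \widetilde\alpha_T=\frac{X_T\int_0^TX_s^2\,ds-\frac12X_T^2\int_0^TX_s\,ds}{T\int_0^TX_s^2\,ds-\left(\int_0^TX_s\,ds\right)^2},\qquad \widetilde\mu_T=\frac{\int_0^TX_s^2\,ds-\frac12X_T\int_0^TX_s\,ds}{\frac12TX_T-\int_0^TX_s\,ds}$$ (so that $\widetilde\mu_T=\widetilde\alpha_T/\widetilde\theta_T$ where these are defined), and let $$\xi_T=e^{-\theta T}\int_0^Te^{\theta s}\,dG_s\quad\text{(Young integral)},\qquad \zeta_\infty=\theta\int_0^\infty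 e^{-\theta s}G_s\,ds .$$ Assume - $(\mathcal A_1)$ $G_0=0$ almost surely, and there are $c>0$, $\gamma\in(0,1)$ with $E[(G_t-G_s)^2]\le c|t-s|^{2\gamma}$ for all $s,t\ge 0$; - $(\mathcal A_2)$ $\lambda_G>0$, $\eta\in(0,1)$ and $E[G_T^2]/T^{2\eta}\to\lambda_G^2$ as $T\to\infty$; - $(\mathcal A_3)$ $\sigma_G>0$ and $E[\xi_T^2]\to\sigma_G^2$ as $T\to\infty$; - $(\mathcal A_4)$ for every fixed $s\ge 0$, $E[G_s\,\xi_T]\to 0$ as $T\to\infty$; and assume $\mu+\zeta_\infty\neq 0$ almost surely (equivalently, $\mu\ne0$ or the centered Gaussian variable $\zeta_\infty$ has positive variance). Let $N_1,N_2\sim\mathcal N(0,1)$ be such that $N_1$, $N_2$ and $G$ are independent. Then, in law as $T\to\infty$, $$e^{\theta T}(\widetilde\theta_T-\theta)\to\frac{2\theta\sigma_GN_2}{\mu+\zeta_\infty},\qquad T^{1-\eta}(\widetilde\mu_T-\mu)\to\frac{\lambda_G}{\theta}N_1,\qquad T^{1-\eta}(\widetilde\alpha_T-\alpha)\to\lambda_GN_1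 .$$ If moreover - $(\mathcal A_5)$ for every fixed $s\ge 0$, $E[G_sG_T]/T^\eta\to 0$, and $E\left[\frac{G_T}{T^\eta}\,\xi_T\right]\to 0$ as $T\to\infty$, then, jointly in law as $T\to\infty$, $$\left(e^{\theta T}(\widetilde\theta_T-\theta),\,T^{1-\eta}(\widetilde\mu_T-\mu)\right)\to\left(\frac{2\theta\sigma_GN_2}{\mu+\zeta_\infty},\,\frac{\lambda_G}{\theta}N_1\right),$$ $$\left(e^{\theta T}(\widetilde\theta_T-\theta),\,T^{1-\eta}(\widetilde\alpha_T-\alpha)\right)\to\left(\frac{2\theta\sigma_GN_2}{\mu+\zeta_\infty},\,\lambda_GN_1\right).$$ -/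

import Mathlib

open MeasureTheory ProbabilityTheory Filter Topology
open scoped NNReal

namespace Vasicek

/-- `I` is the Young (Riemann-Stieltjes) integral of `f` against `g` over `[0, T]`: all tagged
Riemann-Stieltjes sums over partitions of `[0, T]` of small enough mesh are close to `I`. -/
def IsYoungIntegral (f g : ℝ≥0 → ℝ) (T : ℝ≥0) (I : ℝ) : Prop :=
  ∀ ε : ℝ, 0 < ε → ∃ δ : ℝ, 0 < δ ∧
    ∀ (n : ℕ) (t τ : ℕ → ℝ≥0), Monotone t → t 0 = 0 → t n = T →
      (∀ i < n, (t (i + 1) : ℝ) - (t i : ℝ) < δ) →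
      (∀ i < n, t i ≤ τ i ∧ τ i ≤ t (i + 1)) →
      |∑ i ∈ Finset.range n, f (τ i) * (g (t (i + 1)) - g (t i)) - I| < ε

open Classical in
/-- The Young integral `∫₀ᵀ f dg` (with value `0` if it does not exist). -/
noncomputable def youngIntegral (f g : ℝ≥0 → ℝ) (T : ℝ≥0) : ℝ :=
  if h : ∃ I, IsYoungIntegral f g T I then h.choose else 0

/-- The ordinary integral `∫₀ᵀ f(s) ds` of a function of time `s ≥ 0`. -/
noncomputable def timeIntegral (f : ℝ≥0 → ℝ) (T : ℝ≥0) : ℝ :=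
  ∫ s in (0 : ℝ)..(T : ℝ), f s.toNNReal

/-- `G` is a centered real Gaussian process indexed by `[0, ∞)` with continuous paths. -/
structure IsCenteredGaussian {Ω : Type*} [MeasurableSpace Ω] (G : ℝ≥0 → Ω → ℝ)
    (P : Measure Ω) : Prop where
  measurable : ∀ t, Measurable (G t)
  gaussian : IsGaussianProcess G P
  centered : ∀ t, ∫ ω, G t ω ∂P = 0
  continuous : ∀ ω, Continuous fun t => G t ω

/-- `X` solves `X₀ = 0`, `dX_t = θ (μ + X_t) dt + dG_t` pathwise. -/
structure IsSolution {Ω : Type*} (θ μ : ℝ) (G X : ℝ≥0 → Ω → ℝ) : Prop where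
  continuous : ∀ ω, Continuous fun t => X t ω
  zero : ∀ ω, X 0 ω = 0
  equation : ∀ ω t, X t ω = timeIntegral (fun s => θ * (μ + X s ω)) t + (G t ω - G 0 ω)

/-- `ζ_∞ = θ ∫₀^∞ e^{-θ s} G_s ds`. -/
noncomputable def zetaInfty {Ω : Type*} (θ : ℝ) (G : ℝ≥0 → Ω → ℝ) (ω : Ω) : ℝ :=
  θ * ∫ s in Set.Ioi (0 : ℝ), Real.exp (-θ * s) * G s.toNNReal ω

/-- `e^{-θ T} ∫₀ᵀ e^{θ s} dG_s`. -/
noncomputable def expNoise {Ω : Type*} (θ : ℝ) (G : ℝ≥0 → Ω → ℝ) (T : ℝ≥0) (ω : Ω) : ℝ :=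
  Real.exp (-θ * T) * youngIntegral (fun s => Real.exp (θ * s)) (fun s => G s ω) T

/-- The least squares-type estimator of `θ` computed from the path `x` on `[0, T]`. -/
noncomputable def thetaTilde (x : ℝ≥0 → ℝ) (T : ℝ≥0) : ℝ :=
  (1 / 2 * (T : ℝ) * x T ^ 2 - x T * timeIntegral x T) /
    ((T : ℝ) * timeIntegral (fun s => x s ^ 2) T - timeIntegral x T ^ 2)

/-- The least squares-type estimator of `α = θ μ` computed from the path `x` on `[0, T]`. -/
noncomputable def alphaTilde (x : ℝ≥0 → ℝ) (T : ℝ≥0) : ℝ :=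
  (x T * timeIntegral (fun s => x s ^ 2) T - 1 / 2 * x T ^ 2 * timeIntegral x T) /
    ((T : ℝ) * timeIntegral (fun s => x s ^ 2) T - timeIntegral x T ^ 2)

/-- The least squares-type estimator of `μ` computed from the path `x` on `[0, T]`. -/
noncomputable def muTilde (x : ℝ≥0 → ℝ) (T : ℝ≥0) : ℝ :=
  (timeIntegral (fun s => x s ^ 2) T - 1 / 2 * x T * timeIntegral x T) /
    (1 / 2 * (T : ℝ) * x T - timeIntegral x T)

/-- The estimator of `μ` is the quotient of the estimators of `α` and `θ`. -/
theorem muTilde_eq_div (x : ℝ≥0 → ℝ) (T : ℝ≥0) (hx : x T ≠ 0)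
    (hd : (T : ℝ) * timeIntegral (fun s => x s ^ 2) T - timeIntegral x T ^ 2 ≠ 0) :
    muTilde x T = alphaTilde x T / thetaTilde x T := by
  unfold muTilde alphaTilde thetaTilde
  rw [div_div_div_cancel_right₀ hd, ← mul_div_mul_left _ _ hx]
  congr 1 <;> ring

/-- `G₀ = 0` and `E[(G_t - G_s)²] ≤ c |t - s|^{2γ}` for some `c > 0` and `γ ∈ (0, 1)`. -/
def AssumptionA1 {Ω : Type*} [MeasurableSpace Ω] (G : ℝ≥0 → Ω → ℝ) (P : Measure Ω) : Prop :=
  (∀ᵐ ω ∂P, G 0 ω = 0) ∧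
    ∃ c γ : ℝ, 0 < c ∧ 0 < γ ∧ γ < 1 ∧
      ∀ s t : ℝ≥0, ∫ ω, (G t ω - G s ω) ^ 2 ∂P ≤ c * |(t : ℝ) - (s : ℝ)| ^ (2 * γ)

/-- `λ > 0`, `η ∈ (0, 1)` and `E[G_T²] / T^{2η} → λ²` (with `l` for `λ`). -/
def AssumptionA2 {Ω : Type*} [MeasurableSpace Ω] (G : ℝ≥0 → Ω → ℝ) (P : Measure Ω)
    (l η : ℝ) : Prop :=
  0 < l ∧ 0 < η ∧ η < 1 ∧
    Tendsto (fun T : ℝ≥0 => (∫ ω, G T ω ^ 2 ∂P) / (T : ℝ) ^ (2 * η)) atTop (𝓝 (l ^ 2))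

/-- `σ > 0` and `E[(e^{-θ T} ∫₀ᵀ e^{θ s} dG_s)²] → σ²`. -/
def AssumptionA3 {Ω : Type*} [MeasurableSpace Ω] (θ : ℝ) (G : ℝ≥0 → Ω → ℝ) (P : Measure Ω)
    (σ : ℝ) : Prop :=
  0 < σ ∧ Tendsto (fun T : ℝ≥0 => ∫ ω, expNoise θ G T ω ^ 2 ∂P) atTop (𝓝 (σ ^ 2))

/-- `E[G_s e^{-θ T} ∫₀ᵀ e^{θ r} dG_r] → 0` for every fixed `s ≥ 0`. -/
def AssumptionA4 {Ω : Type*} [MeasurableSpace Ω] (θ : ℝ) (G : ℝ≥0 → Ω → ℝ)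
    (P : Measure Ω) : Prop :=
  ∀ s : ℝ≥0, Tendsto (fun T : ℝ≥0 => ∫ ω, G s ω * expNoise θ G T ω ∂P) atTop (𝓝 0)

/-- `E[G_s G_T] / T^η → 0` for every fixed `s ≥ 0`, and
`E[(G_T / T^η) e^{-θ T} ∫₀ᵀ e^{θ r} dG_r] → 0`. -/
def AssumptionA5 {Ω : Type*} [MeasurableSpace Ω] (θ : ℝ) (G : ℝ≥0 → Ω → ℝ) (P : Measure Ω)
    (η : ℝ) : Prop :=
  (∀ s : ℝ≥0, Tendsto (fun T : ℝ≥0 => (∫ ω, G s ω * G T ω ∂P) / (T : ℝ) ^ η) atTop (𝓝 0)) ∧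
    Tendsto (fun T : ℝ≥0 => ∫ ω, G T ω / (T : ℝ) ^ η * expNoise θ G T ω ∂P) atTop (𝓝 0)

end Vasicek

namespace Vasicek

/-! Variation of constants gives X_t = e^{θt} W_t − μ + G_t with W_t = μ + θ∫₀ᵗ e^{-θs} G_s ds.
Since ∫ e^{-θs/2} G_s² ds is almost surely finite, W_t tends to W = μ + ζ_∞ at rate e^{-θt/2}, so
X_T grows like e^{θT} W.

Write I₁ = ∫X, I₂ = ∫X² and J = X_T²/2 − θμ I₁ − θ I₂, which plays the role of ∫X dG. Algebra gives
exact errors: θ̃ − θ = (T J − G I₁)/(T I₂ − I₁²), α̃ − α = (G I₂ − J I₁)/(T I₂ − I₁²), and μ̃ − μ =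
(X G/2 − J)/(θ (T X/2 − I₁)). Integration by parts shows e^{-θT} J − W ξ_T → 0, and e^{-2θT}(T I₂ −
I₁²)/T → W²/(2θ). Hence the normalized errors are 2θ ξ_T/W, G_T/(θ T^η) and G_T/T^η, up to terms
vanishing in probability (`tendsto_renormalized_sub`, `tendsto_estimators_sub`).

It remains to find the joint limit law of (ξ_T, G_T/T^η, ζ_∞). All three lie in one space of
centered Gaussian variables, obtained from the span of the G_t by almost sure limits. There
convergence in law reduces to convergence of covariances, and vanishing covariances give
independence in the limit (`IsGaussianSpace.tendstoInDistribution_triple`). Asymptotic orthogonality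
to each G_s passes to ζ_∞ because almost sure limits of Gaussian variables are mean square limits.
The mapping theorem for (a, b, h) ↦ (2θa/(μ+h), b), continuous where μ + h ≠ 0, and Slutsky's lemma
conclude. -/

/-! ### Young integrals of smooth integrands -/

/-- Integrating by parts on [a, τ] and on [τ, b] separately, the error is exactly ∫_a^τ f'(g − g(a))
+ ∫_τ^b f'(g − g(b)), which the oscillation of g controls. -/
theorem abs_stieltjes_term_le {f f' g : ℝ → ℝ} (hf : ∀ x, HasDerivAt f (f' x) x)
    (hf' : Continuous f') (hg : Continuous g) {a b τ M ε : ℝ} (ha : a ≤ τ) (hb : τ ≤ b)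
    (hM : ∀ s ∈ Set.Icc a b, |f' s| ≤ M) (hε : ∀ s ∈ Set.Icc a b, ∀ r ∈ Set.Icc a b,
      |g s - g r| ≤ ε) :
    |f τ * (g b - g a) - (f b * g b - f a * g a - ∫ s in a..b, f' s * g s)| ≤
      M * ε * (b - a) := by
  have hint : ∀ (c u v : ℝ), IntervalIntegrable (fun s => f' s * (g s - c)) volume u v :=
    fun c u v => (hf'.mul (hg.sub continuous_const)).intervalIntegrable _ _
  have hsub : ∀ u v c, ∫ s in u..v, f' s * (g s - c) =
      (∫ s in u..v, f' s * g s) - (f v - f u) * c := by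
    intro u v c
    rw [← intervalIntegral.integral_eq_sub_of_hasDerivAt (fun x _ => hf x)
      (hf'.intervalIntegrable _ _), ← intervalIntegral.integral_mul_const,
      ← intervalIntegral.integral_sub]
    · simp only [mul_sub]
    · exact (hf'.mul hg).intervalIntegrable _ _
    · exact (hf'.mul continuous_const).intervalIntegrable _ _
  have hadd : (∫ s in a..b, f' s * g s) =
      (∫ s in a..τ, f' s * g s) + ∫ s in τ..b, f' s * g s :=
    (intervalIntegral.integral_add_adjacent_intervals
      ((hf'.mul hg).intervalIntegrable _ _) ((hf'.mul hg).intervalIntegrable _ _)).symm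
  have key : f τ * (g b - g a) - (f b * g b - f a * g a - ∫ s in a..b, f' s * g s) =
      (∫ s in a..τ, f' s * (g s - g a)) + ∫ s in τ..b, f' s * (g s - g b) := by
    rw [hsub, hsub, hadd]; ring
  have hab : a ≤ b := ha.trans hb
  have hM0 : 0 ≤ M := (abs_nonneg _).trans (hM a ⟨le_rfl, hab⟩)
  have bound : ∀ u v c, a ≤ u → u ≤ v → v ≤ b → c ∈ Set.Icc a b →
      |∫ s in u..v, f' s * (g s - g c)| ≤ M * ε * (v - u) := by
    intro u v c hu huv hv hc
    have := intervalIntegral.norm_integral_le_of_norm_le_const (a := u) (b := v) (C := M * ε)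
      (f := fun s => f' s * (g s - g c)) (fun s hs => by
        rw [Set.uIoc_of_le huv] at hs
        have hs' : s ∈ Set.Icc a b := ⟨hu.trans hs.1.le, hs.2.trans hv⟩
        rw [Real.norm_eq_abs, abs_mul]
        exact mul_le_mul (hM s hs') (hε s hs' c hc) (abs_nonneg _) hM0)
    rwa [Real.norm_eq_abs, abs_of_nonneg (sub_nonneg.2 huv)] at this
  rw [key]
  refine (abs_add_le _ _).trans ?_
  have h1 := bound a τ a le_rfl ha hb ⟨le_rfl, hab⟩
  have h2 := bound τ b b ha hb le_rfl ⟨hab, le_rfl⟩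
  linarith

/-- Integration by parts: a continuously differentiable function has a Young integral against
every continuous path. -/
theorem isYoungIntegral_of_hasDerivAt {f f' : ℝ → ℝ} (hf : ∀ x, HasDerivAt f (f' x) x)
    (hf' : Continuous f') {g : ℝ≥0 → ℝ} (hg : Continuous g) (T : ℝ≥0) :
    IsYoungIntegral (fun s => f s) g T
      (f T * g T - f 0 * g 0 - ∫ s in (0 : ℝ)..T, f' s * g s.toNNReal) := by
  set h : ℝ → ℝ := fun s => g s.toNNReal with hh
  have hhc : Continuous h := hg.comp continuous_real_toNNReal
  obtain ⟨M, hM⟩ := (isCompact_Icc (a := (0 : ℝ)) (b := T)).exists_bound_of_continuousOn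
    hf'.continuousOn
  have hM0 : 0 ≤ M := (norm_nonneg _).trans (hM 0 ⟨le_rfl, T.2⟩)
  have huc := (isCompact_Icc (a := (0 : ℝ)) (b := T)).uniformContinuousOn_of_continuous
    hhc.continuousOn
  intro ε hε
  -- The total error will be at most M e T; the added 1 keeps the denominator positive and makes the
  -- final inequality strict.
  set e : ℝ := ε / (M * T + 1) with he
  have hMT : 0 < M * T + 1 := by positivity
  have he0 : 0 < e := by positivity
  obtain ⟨δ, hδ, hδe⟩ := Metric.uniformContinuousOn_iff.1 huc e he0
  refine ⟨δ, hδ, fun n t τ ht ht0 htn hmesh hτ => ?_⟩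
  -- The integration by parts expression is additive over the partition, so the error splits into
  -- one term per interval.
  have htel : f T * g T - f 0 * g 0 - ∫ s in (0 : ℝ)..T, f' s * h s =
      ∑ i ∈ Finset.range n, (f (t (i + 1)) * h (t (i + 1)) - f (t i) * h (t i) -
        ∫ s in (t i : ℝ)..t (i + 1), f' s * h s) := by
    rw [Finset.sum_sub_distrib, Finset.sum_range_sub (fun i => f (t i) * h (t i)),
      intervalIntegral.sum_integral_adjacent_intervals (a := fun i => (t i : ℝ))
        (f := fun s => f' s * h s)
        (fun k _ => (hf'.mul hhc).intervalIntegrable _ _)]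
    simp [ht0, htn, hh]
  have hsum : |∑ i ∈ Finset.range n, f (τ i) * (g (t (i + 1)) - g (t i)) -
      (f T * g T - f 0 * g 0 - ∫ s in (0 : ℝ)..T, f' s * h s)| ≤ M * e * T := by
    rw [htel, ← Finset.sum_sub_distrib]
    refine (Finset.abs_sum_le_sum_abs _ _).trans ?_
    have hT : (T : ℝ) = ∑ i ∈ Finset.range n, ((t (i + 1) : ℝ) - t i) := by
      rw [Finset.sum_range_sub (fun i => (t i : ℝ))]; simp [ht0, htn]
    rw [hT, Finset.mul_sum]
    refine Finset.sum_le_sum fun i hi => ?_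
    have hi' := Finset.mem_range.1 hi
    have hiT : (t (i + 1) : ℝ) ≤ T := by
      rw [← htn]; exact_mod_cast ht (by omega : i + 1 ≤ n)
    have hin : ∀ s ∈ Set.Icc (t i : ℝ) (t (i + 1)), s ∈ Set.Icc (0 : ℝ) T :=
      fun s hs => ⟨(t i).2.trans hs.1, hs.2.trans hiT⟩
    have := abs_stieltjes_term_le hf hf' hhc (a := t i) (b := t (i + 1)) (τ := τ i) (M := M)
      (ε := e) (by exact_mod_cast (hτ i hi').1) (by exact_mod_cast (hτ i hi').2)
      (fun s hs => hM s (hin s hs)) (fun s hs r hr => by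
        refine (hδe s (hin s hs) r (hin r hr) ?_).le
        have := hmesh i hi'
        rw [Real.dist_eq, abs_lt]
        constructor <;> linarith [hs.1, hs.2, hr.1, hr.2])
    simpa [hh] using this
  refine hsum.trans_lt ?_
  calc M * e * T = (M * T) * e := by ring
    _ < (M * T + 1) * e := by nlinarith
    _ = ε := by rw [he]; field_simp

/-- The Riemann-Stieltjes sums over uniform partitions converge to the Young integral. -/
theorem IsYoungIntegral.tendsto_uniform {f g : ℝ≥0 → ℝ} {T : ℝ≥0} {I : ℝ}
    (h : IsYoungIntegral f g T I) :
    Tendsto (fun n : ℕ => ∑ i ∈ Finset.range (n + 1), f (T * i / (n + 1)) *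
      (g (T * (i + 1 : ℕ) / (n + 1)) - g (T * i / (n + 1)))) atTop (𝓝 I) := by
  rw [Metric.tendsto_atTop]
  intro ε hε
  obtain ⟨δ, hδ, hI⟩ := h ε hε
  obtain ⟨N, hN⟩ := exists_nat_gt ((T : ℝ) / δ)
  refine ⟨N, fun n hn => ?_⟩
  rw [Real.dist_eq]
  have hmono : Monotone fun i : ℕ => (T * i / (n + 1) : ℝ≥0) := by
    intro i j hij
    dsimp only
    gcongr
  have hn1 : (0 : ℝ) < n + 1 := by positivity
  refine hI (n + 1) (fun i => T * i / (n + 1)) (fun i => T * i / (n + 1)) hmono (by simp) ?_ ?_ ?_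
  · push_cast; field_simp
  · intro i _
    push_cast
    rw [← sub_div, div_lt_iff₀ hn1]
    have : (T : ℝ) < N * δ := (div_lt_iff₀ hδ).1 hN
    have hNn : (N : ℝ) ≤ n := by exact_mod_cast hn
    nlinarith
  · intro i _
    exact ⟨le_rfl, hmono (Nat.le_succ i)⟩

theorem IsYoungIntegral.unique {f g : ℝ≥0 → ℝ} {T : ℝ≥0} {I I' : ℝ}
    (h : IsYoungIntegral f g T I) (h' : IsYoungIntegral f g T I') : I = I' :=
  tendsto_nhds_unique h.tendsto_uniform h'.tendsto_uniform

theorem IsYoungIntegral.youngIntegral_eq {f g : ℝ≥0 → ℝ} {T : ℝ≥0} {I : ℝ}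
    (h : IsYoungIntegral f g T I) : youngIntegral f g T = I := by
  have hex : ∃ I, IsYoungIntegral f g T I := ⟨I, h⟩
  rw [youngIntegral, dif_pos hex]
  exact hex.choose_spec.unique h

/-- The Young integral of an exponential, after integration by parts. -/
theorem isYoungIntegral_exp (a : ℝ) {g : ℝ≥0 → ℝ} (hg : Continuous g) (T : ℝ≥0) :
    IsYoungIntegral (fun s => Real.exp (a * s)) g T
      (Real.exp (a * T) * g T - g 0 -
        a * ∫ s in (0 : ℝ)..T, Real.exp (a * s) * g s.toNNReal) := by
  have h := isYoungIntegral_of_hasDerivAt (f := fun s => Real.exp (a * s))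
    (f' := fun s => a * Real.exp (a * s)) (fun x => by
      simpa [mul_comm] using ((hasDerivAt_id x).const_mul a).exp) (by fun_prop) hg T
  simpa [mul_assoc, intervalIntegral.integral_const_mul] using h

/-! ### Deterministic analysis of one path -/

/-- `μ + θ ∫₀ᵗ e^{-θ s} g(s) ds`. -/
noncomputable def discountedPath (θ μ : ℝ) (g : ℝ → ℝ) (t : ℝ) : ℝ :=
  μ + θ * ∫ s in (0 : ℝ)..t, Real.exp (-θ * s) * g s

/-- `g(T) - θ e^{-θ T} ∫₀ᵀ e^{θ s} g(s) ds`. -/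
noncomputable def noisePath (θ : ℝ) (g : ℝ → ℝ) (T : ℝ) : ℝ :=
  g T - θ * Real.exp (-θ * T) * ∫ s in (0 : ℝ)..T, Real.exp (θ * s) * g s

section Pathwise

variable {θ μ : ℝ} {g x : ℝ → ℝ}

theorem hasDerivAt_discountedPath (θ μ : ℝ) (hg : Continuous g) (t : ℝ) :
    HasDerivAt (discountedPath θ μ g) (θ * (Real.exp (-θ * t) * g t)) t := by
  have hc : Continuous fun s => Real.exp (-θ * s) * g s := by fun_prop
  exact ((intervalIntegral.integral_hasDerivAt_right (hc.intervalIntegrable _ _)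
    (hc.stronglyMeasurableAtFilter _ _)
      hc.continuousAt).const_mul θ).const_add μ

theorem continuous_discountedPath (θ μ : ℝ) (hg : Continuous g) :
    Continuous (discountedPath θ μ g) :=
  continuous_iff_continuousAt.2 fun t => (hasDerivAt_discountedPath θ μ hg t).continuousAt

theorem exp_neg_mul_self (θ t : ℝ) : Real.exp (-θ * t) * Real.exp (θ * t) = 1 := by
  rw [← Real.exp_add]; simp

/-- Variation of constants for the linear equation `dx = θ (μ + x) dt + dg`. -/
theorem solution_eq (hg : Continuous g) (hx : Continuous x)
    (h : ∀ t, 0 ≤ t → x t = (∫ s in (0 : ℝ)..t, θ * (μ + x s)) + g t) {t : ℝ} (ht : 0 ≤ t) :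
    x t = Real.exp (θ * t) * discountedPath θ μ g t - μ + g t := by
  set A : ℝ → ℝ := fun t => ∫ s in (0 : ℝ)..t, θ * (μ + x s) with hA
  have hAd : ∀ t, HasDerivAt A (θ * (μ + x t)) t := fun t => by
    have hc : Continuous fun s => θ * (μ + x s) := by fun_prop
    exact intervalIntegral.integral_hasDerivAt_right (hc.intervalIntegrable _ _)
      (hc.stronglyMeasurableAtFilter _ _)
      hc.continuousAt
  have hAc : Continuous A := continuous_iff_continuousAt.2 fun t => (hAd t).continuousAt
  have hed : ∀ t, HasDerivAt (fun t => Real.exp (-θ * t)) (-θ * Real.exp (-θ * t)) t := fun t => by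
    simpa [mul_comm] using ((hasDerivAt_id t).const_mul (-θ)).exp
  -- The function e^{-θs}(μ + A s) − `discountedPath` is constant on [0, t]: its derivative vanishes
  -- because A' = θ(μ + A + g) there.
  have key := intervalIntegral.integral_eq_sub_of_hasDerivAt (a := 0) (b := t)
    (fun s _ => ((hed s).mul ((hAd s).const_add μ)).sub (hasDerivAt_discountedPath θ μ hg s))
    (Continuous.intervalIntegrable (by fun_prop) _ _)
  rw [intervalIntegral.integral_congr (g := fun _ => 0)] at key
  · have hA0 : A 0 = 0 := by simp [hA]
    have hW0 : discountedPath θ μ g 0 = μ := by simp [discountedPath]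
    simp only [intervalIntegral.integral_zero, Pi.sub_apply, Pi.mul_apply, hA0, hW0, mul_zero,
      Real.exp_zero] at key
    have h1 := exp_neg_mul_self θ t
    have h2 : discountedPath θ μ g t = Real.exp (-θ * t) * (μ + A t) := by
      linarith
    rw [h t ht, h2]
    linear_combination (-(μ + A t)) * h1
  · intro s hs
    rw [Set.uIcc_of_le ht] at hs
    have := h s hs.1
    change x s = A s + g s at this
    simp only
    rw [this]
    ring

theorem integral_solution (hθ : θ ≠ 0) (hx : Continuous x)
    (h : ∀ t, 0 ≤ t → x t = (∫ s in (0 : ℝ)..t, θ * (μ + x s)) + g t) {T : ℝ} (hT : 0 ≤ T) :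
    ∫ s in (0 : ℝ)..T, x s = (x T - g T) / θ - μ * T := by
  have h1 := h T hT
  rw [intervalIntegral.integral_const_mul, intervalIntegral.integral_add
    intervalIntegrable_const (hx.intervalIntegrable _ _)] at h1
  simp at h1
  field_simp
  linarith

/-- The pathwise stochastic integral `∫ x dg`, computed by integration by parts. -/
theorem half_sq_sub_eq (hg : Continuous g) (hx : Continuous x)
    (h : ∀ t, 0 ≤ t → x t = (∫ s in (0 : ℝ)..t, θ * (μ + x s)) + g t) {T : ℝ} (hT : 0 ≤ T) :
    1 / 2 * x T ^ 2 - θ * μ * (∫ s in (0 : ℝ)..T, x s) - θ * ∫ s in (0 : ℝ)..T, x s ^ 2 =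
      Real.exp (θ * T) * discountedPath θ μ g T * g T - μ * g T + 1 / 2 * g T ^ 2 -
        θ * (∫ s in (0 : ℝ)..T, g s ^ 2) -
        θ * ∫ s in (0 : ℝ)..T, Real.exp (θ * s) * discountedPath θ μ g s * g s := by
  have hWc := continuous_discountedPath θ μ hg
  set A : ℝ → ℝ := fun t => ∫ s in (0 : ℝ)..t, θ * (μ + x s) with hA
  have hAd : ∀ t, HasDerivAt A (θ * (μ + x t)) t := fun t => by
    have hc : Continuous fun s => θ * (μ + x s) := by fun_prop
    exact intervalIntegral.integral_hasDerivAt_right (hc.intervalIntegrable _ _)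
      (hc.stronglyMeasurableAtFilter _ _)
      hc.continuousAt
  have hAc : Continuous A := continuous_iff_continuousAt.2 fun t => (hAd t).continuousAt
  have key := intervalIntegral.integral_eq_sub_of_hasDerivAt (a := 0) (b := T)
    (fun s _ => (hAd s).pow 2) (Continuous.intervalIntegrable (by fun_prop) _ _)
  have hA0 : A 0 = 0 := by simp [hA]
  have hxA : ∀ s, 0 ≤ s → x s = A s + g s := h
  have hAW : ∀ s, 0 ≤ s → A s = Real.exp (θ * s) * discountedPath θ μ g s - μ := fun s hs => by
    have := solution_eq hg hx h hs
    rw [hxA s hs] at this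
    linarith
  -- As x = A + g and A' = θ(μ + x), the integrand θ(μ + x)x equals A A' + θg² + θ(A + μ)g, where A
  -- + μ = e^{θs} `discountedPath`.
  have e1 : θ * μ * (∫ s in (0 : ℝ)..T, x s) + θ * ∫ s in (0 : ℝ)..T, x s ^ 2 =
      1 / 2 * (A T) ^ 2 + (θ * (∫ s in (0 : ℝ)..T, g s ^ 2) +
        θ * ∫ s in (0 : ℝ)..T, Real.exp (θ * s) * discountedPath θ μ g s * g s) := by
    have : 1 / 2 * A T ^ 2 = 1 / 2 * ∫ s in (0 : ℝ)..T, (2 : ℕ) * A s ^ (2 - 1) *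
        (θ * (μ + x s)) := by
      rw [key]; simp [hA0]
    rw [this]
    simp only [← intervalIntegral.integral_const_mul]
    rw [← intervalIntegral.integral_add, ← intervalIntegral.integral_add,
      ← intervalIntegral.integral_add]
    · refine intervalIntegral.integral_congr fun s hs => ?_
      rw [Set.uIcc_of_le hT] at hs
      have h1 := hxA s hs.1
      have h2 := hAW s hs.1
      have h3 : Real.exp (θ * s) * discountedPath θ μ g s = A s + μ := by linarith
      simp only [h3, h1]
      push_cast
      ring
    all_goals exact Continuous.intervalIntegrable (by fun_prop) _ _
  have h4 := hxA T hT
  have h5 := hAW T hT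
  have h6 : Real.exp (θ * T) * discountedPath θ μ g T = A T + μ := by linarith
  rw [sub_sub, e1, h4, h6]
  ring

theorem abs_le_one_add_sq (y : ℝ) : |y| ≤ 1 + y ^ 2 := by
  rw [abs_le]
  constructor <;> nlinarith [sq_nonneg (y + 1), sq_nonneg (y - 1)]

/-- The weighted square integrability `hK` stands in for a pathwise growth bound on g; the pathwise
estimates over the whole half-line rest on it. -/
theorem integrableOn_exp_mul (hθ : 0 < θ) (hg : Continuous g)
    (hK : IntegrableOn (fun s => Real.exp (-(θ / 2) * s) * g s ^ 2) (Set.Ioi 0)) :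
    IntegrableOn (fun s => Real.exp (-θ * s) * g s) (Set.Ioi 0) := by
  have h1 : IntegrableOn (fun s => Real.exp (-θ * s)) (Set.Ioi 0) :=
    integrableOn_exp_mul_Ioi (by linarith) 0
  refine (h1.add hK).mono' (by fun_prop) ?_
  refine (ae_restrict_iff' measurableSet_Ioi).2 (ae_of_all _ fun s hs => ?_)
  have hs : 0 < s := hs
  rw [Real.norm_eq_abs, abs_mul, Real.abs_exp]
  have h2 : Real.exp (-θ * s) ≤ Real.exp (-(θ / 2) * s) := Real.exp_le_exp.2 (by nlinarith)
  have h3 := abs_le_one_add_sq (g s)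
  calc Real.exp (-θ * s) * |g s| ≤ Real.exp (-θ * s) * (1 + g s ^ 2) := by gcongr
    _ = Real.exp (-θ * s) + Real.exp (-θ * s) * g s ^ 2 := by ring
    _ ≤ _ := by simp only [Pi.add_apply]; gcongr

/-- `discountedPath` converges exponentially fast. -/
theorem exists_abs_discountedPath_sub_le (μ : ℝ) (hθ : 0 < θ) (hg : Continuous g)
    (hK : IntegrableOn (fun s => Real.exp (-(θ / 2) * s) * g s ^ 2) (Set.Ioi 0)) :
    ∃ C, 0 ≤ C ∧ ∀ t, 0 ≤ t → |discountedPath θ μ g t -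
      (μ + θ * ∫ s in Set.Ioi (0 : ℝ), Real.exp (-θ * s) * g s)| ≤
        C * Real.exp (-(θ / 2) * t) := by
  have hi := integrableOn_exp_mul hθ hg hK
  have h1 : IntegrableOn (fun s => Real.exp (-(θ / 2) * s)) (Set.Ioi 0) :=
    integrableOn_exp_mul_Ioi (by linarith) 0
  set f : ℝ → ℝ := fun s => Real.exp (-(θ / 2) * s) + Real.exp (-(θ / 2) * s) * g s ^ 2 with hf
  have hfi : IntegrableOn f (Set.Ioi 0) := h1.add hK
  have hf0 : ∀ s, 0 ≤ f s := fun s => by positivity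
  refine ⟨θ * ∫ s in Set.Ioi 0, f s, mul_nonneg hθ.le (integral_nonneg hf0), fun t ht => ?_⟩
  have hsplit : (∫ s in Set.Ioi (0 : ℝ), Real.exp (-θ * s) * g s) =
      (∫ s in (0 : ℝ)..t, Real.exp (-θ * s) * g s) +
        ∫ s in Set.Ioi t, Real.exp (-θ * s) * g s :=
    (intervalIntegral.integral_interval_add_Ioi hi
      (hi.mono_set (Set.Ioi_subset_Ioi ht))).symm
  have h2 : discountedPath θ μ g t -
      (μ + θ * ∫ s in Set.Ioi (0 : ℝ), Real.exp (-θ * s) * g s) =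
        -(θ * ∫ s in Set.Ioi t, Real.exp (-θ * s) * g s) := by
    rw [hsplit, discountedPath]; ring
  rw [h2, abs_neg, abs_mul, abs_of_pos hθ, mul_assoc]
  refine mul_le_mul_of_nonneg_left ?_ hθ.le
  rw [← Real.norm_eq_abs]
  calc ‖∫ s in Set.Ioi t, Real.exp (-θ * s) * g s‖
      ≤ ∫ s in Set.Ioi t, f s * Real.exp (-(θ / 2) * t) := by
        refine norm_integral_le_of_norm_le
          ((hfi.mono_set (Set.Ioi_subset_Ioi ht)).mul_const _) ?_
        refine (ae_restrict_iff' measurableSet_Ioi).2 (ae_of_all _ fun s hs => ?_)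
        have hs : t < s := hs
        rw [Real.norm_eq_abs, abs_mul, Real.abs_exp]
        -- One half of the exponential absorbs |g s|; the other gives the decay in t, as s > t.
        have e2 : Real.exp (-θ * s) = Real.exp (-(θ / 2) * s) * Real.exp (-(θ / 2) * s) := by
          rw [← Real.exp_add]; ring_nf
        have e3 : Real.exp (-(θ / 2) * s) ≤ Real.exp (-(θ / 2) * t) :=
          Real.exp_le_exp.2 (by nlinarith)
        have e4 : Real.exp (-(θ / 2) * s) * |g s| ≤ f s := by
          have := mul_le_mul_of_nonneg_left (abs_le_one_add_sq (g s))
            (Real.exp_pos (-(θ / 2) * s)).le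
          rwa [mul_add, mul_one] at this
        calc Real.exp (-θ * s) * |g s|
            = (Real.exp (-(θ / 2) * s) * |g s|) * Real.exp (-(θ / 2) * s) := by rw [e2]; ring
          _ ≤ f s * Real.exp (-(θ / 2) * t) := mul_le_mul e4 e3 (Real.exp_pos _).le (hf0 s)
    _ = (∫ s in Set.Ioi t, f s) * Real.exp (-(θ / 2) * t) := integral_mul_const _ _
    _ ≤ (∫ s in Set.Ioi 0, f s) * Real.exp (-(θ / 2) * t) := by
        gcongr
        exact ae_of_all _ hf0

theorem tendsto_exp_neg_mul_mul_rpow {a : ℝ} (ha : 0 < a) (r : ℝ) {ι : Type*} {l : Filter ι}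
    {T : ι → ℝ} (hT : Tendsto T l atTop) :
    Tendsto (fun i => Real.exp (-a * T i) * T i ^ r) l (𝓝 0) := by
  have := (tendsto_rpow_mul_exp_neg_mul_atTop_nhds_zero r a ha).comp hT
  simpa [Function.comp_def, mul_comm] using this

theorem tendsto_exp_neg_mul {a : ℝ} (ha : 0 < a) {ι : Type*} {l : Filter ι}
    {T : ι → ℝ} (hT : Tendsto T l atTop) :
    Tendsto (fun i => Real.exp (-a * T i)) l (𝓝 0) := by
  simpa using tendsto_exp_neg_mul_mul_rpow ha 0 hT

/-- The renormalized integral `e^{-θ T} ∫₀ᵀ x dg` is asymptotically equivalent to the limit of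
`discountedPath` times `noisePath`. -/
theorem tendsto_renormalized_sub (hθ : 0 < θ) (hg : Continuous g) (hx : Continuous x)
    (h : ∀ t, 0 ≤ t → x t = (∫ s in (0 : ℝ)..t, θ * (μ + x s)) + g t)
    (hK : IntegrableOn (fun s => Real.exp (-(θ / 2) * s) * g s ^ 2) (Set.Ioi 0))
    {W : ℝ} (hW : W = μ + θ * ∫ s in Set.Ioi (0 : ℝ), Real.exp (-θ * s) * g s)
    {ι : Type*} {l : Filter ι} {T : ι → ℝ} (hT0 : ∀ i, 0 ≤ T i) (hT : Tendsto T l atTop)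
    (hgT : Tendsto (fun i => g (T i) / T i) l (𝓝 0)) :
    Tendsto (fun i => Real.exp (-θ * T i) * (1 / 2 * x (T i) ^ 2 -
        θ * μ * (∫ s in (0 : ℝ)..T i, x s) - θ * ∫ s in (0 : ℝ)..T i, x s ^ 2) -
      W * noisePath θ g (T i)) l (𝓝 0) := by
  obtain ⟨C, hC, hWC⟩ := exists_abs_discountedPath_sub_le μ hθ hg hK
  rw [← hW] at hWC
  have hWc := continuous_discountedPath θ μ hg
  set K := ∫ s in Set.Ioi 0, Real.exp (-(θ / 2) * s) * g s ^ 2 with hKdef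
  have hKT : ∀ T, 0 ≤ T → ∫ s in (0 : ℝ)..T, Real.exp (-(θ / 2) * s) * g s ^ 2 ≤ K := by
    intro T hT
    rw [intervalIntegral.integral_of_le hT]
    exact setIntegral_mono_set hK (ae_of_all _ fun s => by positivity)
      Set.Ioc_subset_Ioi_self.eventuallyLE
  have hK0 : 0 ≤ K := integral_nonneg fun s => by positivity
  have hbound : ∀ T, 0 ≤ T → |Real.exp (-θ * T) * (1 / 2 * x T ^ 2 -
        θ * μ * (∫ s in (0 : ℝ)..T, x s) - θ * ∫ s in (0 : ℝ)..T, x s ^ 2) -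
      W * noisePath θ g T| ≤ C * Real.exp (-(θ / 2) * T) * |g T| +
        Real.exp (-θ * T) * (|μ| * |g T|) + Real.exp (-θ * T) * (1 / 2 * |g T| ^ 2) +
        θ * (Real.exp (-(θ / 2) * T) * K) + θ * (Real.exp (-(θ / 4) * T) * (C * (T + K))) := by
    intro T hT
    -- Replacing `discountedPath` by its limit W in the integration by parts formula produces W
    -- times `noisePath` exactly; the five terms listed are the errors.
    have hid : Real.exp (-θ * T) * (1 / 2 * x T ^ 2 -
        θ * μ * (∫ s in (0 : ℝ)..T, x s) - θ * ∫ s in (0 : ℝ)..T, x s ^ 2) -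
      W * noisePath θ g T = (discountedPath θ μ g T - W) * g T +
        Real.exp (-θ * T) * (-μ * g T) + Real.exp (-θ * T) * (1 / 2 * g T ^ 2) -
        θ * (Real.exp (-θ * T) * ∫ s in (0 : ℝ)..T, g s ^ 2) -
        θ * (Real.exp (-θ * T) *
          ∫ s in (0 : ℝ)..T, Real.exp (θ * s) * (discountedPath θ μ g s - W) * g s) := by
      rw [half_sq_sub_eq hg hx h hT, noisePath]
      have e1 : ∫ s in (0 : ℝ)..T, Real.exp (θ * s) * (discountedPath θ μ g s - W) * g s =
          (∫ s in (0 : ℝ)..T, Real.exp (θ * s) * discountedPath θ μ g s * g s) -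
            W * ∫ s in (0 : ℝ)..T, Real.exp (θ * s) * g s := by
        rw [← intervalIntegral.integral_const_mul, ← intervalIntegral.integral_sub]
        · congr 1; ext s; ring
        all_goals exact Continuous.intervalIntegrable (by fun_prop) _ _
      rw [e1]
      have e2 := exp_neg_mul_self θ T
      linear_combination (discountedPath θ μ g T * g T) * e2
    have b1 : |(discountedPath θ μ g T - W) * g T| ≤ C * Real.exp (-(θ / 2) * T) * |g T| := by
      rw [abs_mul]; exact mul_le_mul_of_nonneg_right (hWC T hT) (abs_nonneg _)
    have b2 : |Real.exp (-θ * T) * (-μ * g T)| = Real.exp (-θ * T) * (|μ| * |g T|) := by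
      rw [abs_mul, abs_mul, abs_neg, Real.abs_exp]
    have b3 : |Real.exp (-θ * T) * (1 / 2 * g T ^ 2)| =
        Real.exp (-θ * T) * (1 / 2 * |g T| ^ 2) := by
      rw [sq_abs]; exact abs_of_nonneg (by positivity)
    have b4 : |θ * (Real.exp (-θ * T) * ∫ s in (0 : ℝ)..T, g s ^ 2)| ≤
        θ * (Real.exp (-(θ / 2) * T) * K) := by
      have hnn : 0 ≤ ∫ s in (0 : ℝ)..T, g s ^ 2 :=
        intervalIntegral.integral_nonneg hT fun s _ => sq_nonneg _
      rw [abs_of_nonneg (by positivity)]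
      refine mul_le_mul_of_nonneg_left ?_ hθ.le
      refine le_trans ?_ (mul_le_mul_of_nonneg_left (hKT T hT) (Real.exp_pos _).le)
      rw [← intervalIntegral.integral_const_mul, ← intervalIntegral.integral_const_mul]
      refine intervalIntegral.integral_mono_on hT (Continuous.intervalIntegrable (by fun_prop) _ _)
        (Continuous.intervalIntegrable (by fun_prop) _ _) fun s hs => ?_
      rw [← mul_assoc, ← Real.exp_add]
      refine mul_le_mul_of_nonneg_right (Real.exp_le_exp.2 ?_) (sq_nonneg _)
      nlinarith [hs.1, hs.2]
    have b5 : |θ * (Real.exp (-θ * T) *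
          ∫ s in (0 : ℝ)..T, Real.exp (θ * s) * (discountedPath θ μ g s - W) * g s)| ≤
        θ * (Real.exp (-(θ / 4) * T) * (C * (T + K))) := by
      rw [abs_mul, abs_of_pos hθ]
      refine mul_le_mul_of_nonneg_left ?_ hθ.le
      rw [← intervalIntegral.integral_const_mul, ← Real.norm_eq_abs]
      have hmaj : ∫ s in (0 : ℝ)..T, Real.exp (-(θ / 4) * T) *
          (C * (1 + Real.exp (-(θ / 2) * s) * g s ^ 2)) ≤
            Real.exp (-(θ / 4) * T) * (C * (T + K)) := by
        rw [intervalIntegral.integral_const_mul, intervalIntegral.integral_const_mul,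
          intervalIntegral.integral_add intervalIntegrable_const
            (Continuous.intervalIntegrable (by fun_prop) _ _)]
        have := hKT T hT
        gcongr
        simp
      refine le_trans (intervalIntegral.norm_integral_le_of_norm_le hT
        (ae_of_all _ fun s hs => ?_) (Continuous.intervalIntegrable (by fun_prop) _ _)) hmaj
      rw [Real.norm_eq_abs, abs_mul, abs_mul, abs_mul, Real.abs_exp, Real.abs_exp]
      have c1 := hWC s hs.1.le
      have c2 : Real.exp (-(θ / 4) * s) * |g s| ≤ 1 + Real.exp (-(θ / 2) * s) * g s ^ 2 := by
        have := abs_le_one_add_sq (Real.exp (-(θ / 4) * s) * g s)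
        rw [abs_mul, Real.abs_exp, mul_pow, sq, ← Real.exp_add] at this
        convert this using 3
        ring_nf
      -- The exponents differ by (3θ/4)(s − T) ≤ 0. The quarter left in s is what |g s| needs to be
      -- bounded through e^{-θs/2} g², and the quarter left in T gives the decay.
      have c3 : Real.exp (-θ * T) * (Real.exp (θ * s) * Real.exp (-(θ / 2) * s)) ≤
          Real.exp (-(θ / 4) * T) * Real.exp (-(θ / 4) * s) := by
        simp only [← Real.exp_add]
        refine Real.exp_le_exp.2 ?_
        nlinarith [hs.1, hs.2]
      calc Real.exp (-θ * T) * (Real.exp (θ * s) * |discountedPath θ μ g s - W| * |g s|)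
          ≤ Real.exp (-θ * T) * (Real.exp (θ * s) * (C * Real.exp (-(θ / 2) * s)) * |g s|) := by
            gcongr
        _ = Real.exp (-θ * T) * (Real.exp (θ * s) * Real.exp (-(θ / 2) * s)) * (C * |g s|) := by
            ring
        _ ≤ Real.exp (-(θ / 4) * T) * Real.exp (-(θ / 4) * s) * (C * |g s|) := by gcongr
        _ = Real.exp (-(θ / 4) * T) * (C * (Real.exp (-(θ / 4) * s) * |g s|)) := by ring
        _ ≤ _ := by gcongr
    rw [hid]
    refine (abs_sub _ _).trans (add_le_add ((abs_sub _ _).trans (add_le_add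
      ((abs_add_le _ _).trans (add_le_add ((abs_add_le _ _).trans (add_le_add b1 b2.le)) b3.le))
      b4)) b5)
  refine squeeze_zero_norm (fun i => hbound (T i) (hT0 i)) ?_
  have hpos : ∀ᶠ i in l, 0 < T i := hT.eventually_gt_atTop 0
  have hq : Tendsto (fun i => |g (T i) / T i|) l (𝓝 0) := by simpa using hgT.abs
  have hlin : ∀ {a : ℝ}, 0 < a → Tendsto (fun i => Real.exp (-a * T i) * |g (T i)|) l (𝓝 0) := by
    intro a ha
    have := (tendsto_exp_neg_mul_mul_rpow ha 1 hT).mul hq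
    rw [mul_zero] at this
    refine this.congr' (hpos.mono fun i hi => ?_)
    simp only [Real.rpow_one]
    rw [abs_div, abs_of_pos hi]
    field_simp
  have hsq : Tendsto (fun i => Real.exp (-θ * T i) * |g (T i)| ^ 2) l (𝓝 0) := by
    have := (hlin (half_pos hθ)).pow 2
    rw [zero_pow two_ne_zero] at this
    refine this.congr fun i => ?_
    rw [mul_pow, sq (Real.exp _), ← Real.exp_add]
    ring_nf
  have t4 := tendsto_exp_neg_mul (half_pos hθ) hT
  have t5 := tendsto_exp_neg_mul_mul_rpow (by linarith : 0 < θ / 4) 1 hT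
  have t6 := tendsto_exp_neg_mul (by linarith : 0 < θ / 4) hT
  have := (((((hlin (half_pos hθ)).const_mul C).add ((hlin hθ).const_mul |μ|)).add
    (hsq.const_mul (1 / 2))).add (t4.const_mul (θ * K))).add
    ((t5.const_mul (θ * C)).add (t6.const_mul (θ * C * K)))
  simp only [mul_zero, add_zero, Real.rpow_one] at this
  refine this.congr fun i => ?_
  ring

end Pathwise

/-! ### Algebra and asymptotics of the estimation errors -/

section Estimators

variable {θ μ η W : ℝ} {ι : Type*} {l : Filter ι} {T X G I₁ I₂ ξ : ι → ℝ}

/-- The estimators, computed from real sequences that behave like the functionals of a solution,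
have the same limits as their leading terms. -/
theorem tendsto_estimators_sub (hθ : 0 < θ) (hη : 0 < η) (hη1 : η < 1) (hW : W ≠ 0)
    (hT : Tendsto T l atTop) (hI₁ : ∀ i, I₁ i = (X i - G i) / θ - μ * T i)
    (hX : Tendsto (fun i => T i * (Real.exp (-θ * T i) * X i - W)) l (𝓝 0))
    (hJ : Tendsto (fun i => Real.exp (-θ * T i) *
      (1 / 2 * X i ^ 2 - θ * μ * I₁ i - θ * I₂ i) - W * ξ i) l (𝓝 0))
    (hG : Tendsto (fun i => G i / T i) l (𝓝 0))
    (hξ : Tendsto (fun i => ξ i / T i ^ η) l (𝓝 0)) :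
    Tendsto (fun i => Real.exp (θ * T i) * ((1 / 2 * T i * X i ^ 2 - X i * I₁ i) /
      (T i * I₂ i - I₁ i ^ 2) - θ) - 2 * θ * ξ i / W) l (𝓝 0) ∧
    Tendsto (fun i => T i ^ (1 - η) * ((I₂ i - 1 / 2 * X i * I₁ i) /
      (1 / 2 * T i * X i - I₁ i) - μ) - G i / T i ^ η / θ) l (𝓝 0) ∧
    Tendsto (fun i => T i ^ (1 - η) * ((X i * I₂ i - 1 / 2 * X i ^ 2 * I₁ i) /
      (T i * I₂ i - I₁ i ^ 2) - θ * μ) - G i / T i ^ η) l (𝓝 0) := by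
  obtain ⟨e, he⟩ : ∃ e : ι → ℝ, ∀ i, e i = Real.exp (-θ * T i) := ⟨_, fun _ => rfl⟩
  obtain ⟨J, hJdef⟩ : ∃ J : ι → ℝ, ∀ i, J i = 1 / 2 * X i ^ 2 - θ * μ * I₁ i - θ * I₂ i :=
    ⟨_, fun _ => rfl⟩
  simp only [← he, ← hJdef] at hX hJ
  have hpos : ∀ᶠ i in l, 0 < T i := hT.eventually_gt_atTop 0
  have hTinv : Tendsto (fun i => (T i)⁻¹) l (𝓝 0) := tendsto_inv_atTop_zero.comp hT
  have hp : Tendsto (fun i => T i ^ (-η)) l (𝓝 0) := (tendsto_rpow_neg_atTop hη).comp hT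
  have hp1 : Tendsto (fun i => T i ^ (η - 1)) l (𝓝 0) := by
    have := (tendsto_rpow_neg_atTop (sub_pos.2 hη1)).comp hT
    simpa [Function.comp_def] using this
  have hTe : Tendsto (fun i => e i * T i) l (𝓝 0) := by
    simpa only [← he, Real.rpow_one] using tendsto_exp_neg_mul_mul_rpow hθ 1 hT
  have hTηe : Tendsto (fun i => e i * T i ^ (1 + η)) l (𝓝 0) := by
    simpa only [← he] using tendsto_exp_neg_mul_mul_rpow hθ (1 + η) hT
  have hx : Tendsto (fun i => e i * X i) l (𝓝 W) := by
    have h1 : Tendsto (fun i => (T i)⁻¹ * (T i * (e i * X i - W)) + W) l (𝓝 W) := by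
      simpa using (hTinv.mul hX).add_const W
    refine h1.congr' (hpos.mono fun i hi => ?_)
    field_simp
    ring
  have hi1 : Tendsto (fun i => e i * I₁ i) l (𝓝 (W / θ)) := by
    have h1 : Tendsto (fun i => (e i * X i - G i / T i * (e i * T i)) / θ - μ * (e i * T i)) l
        (𝓝 (W / θ)) := by
      simpa using ((hx.sub (hG.mul hTe)).div_const θ).sub (hTe.const_mul μ)
    refine h1.congr' (hpos.mono fun i hi => ?_)
    simp only [hI₁ i]
    field_simp
  have hpJ : Tendsto (fun i => T i ^ (-η) * (e i * J i)) l (𝓝 0) := by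
    have h1 : Tendsto (fun i => T i ^ (-η) * (e i * J i - W * ξ i) + W * (ξ i / T i ^ η)) l
        (𝓝 0) := by
      simpa using (hp.mul hJ).add (hξ.const_mul W)
    refine h1.congr' (hpos.mono fun i hi => ?_)
    dsimp only
    rw [Real.rpow_neg hi.le]
    field_simp
    ring
  obtain ⟨D, hD⟩ : ∃ D : ι → ℝ, ∀ i, D i = e i ^ 2 * (I₂ i - I₁ i ^ 2 / T i) :=
    ⟨_, fun _ => rfl⟩
  -- A rate for D is needed, because replacing D by its limit is multiplied by ξ, known only to be
  -- o(T^η). The rate 1/T suffices as η < 1; the nonzero limit c comes from the term I₁²/T in D.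
  obtain ⟨c, hc⟩ : ∃ c, Tendsto (fun i => T i * (W ^ 2 - 2 * θ * D i)) l (𝓝 c) := by
    refine ⟨_, Tendsto.congr' (hpos.mono fun i hi => ?_) ((((hX.mul (hx.add_const W)).neg.add
      ((hi1.mul hTe).const_mul (2 * θ * μ))).add ((hpJ.mul hTηe).const_mul 2)).add
      ((hi1.pow 2).const_mul (2 * θ)))⟩
    have h1 : T i ^ (-η) * T i ^ (1 + η) = T i := by
      rw [← Real.rpow_add hi]; simp
    have h2 : T i ^ (-η) * (e i * J i) * (e i * T i ^ (1 + η)) =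
        T i * (e i * J i * e i) := by
      linear_combination (e i * J i * e i) * h1
    dsimp only
    rw [h2, hD, hJdef]
    field_simp
    ring
  have hDlim : Tendsto D l (𝓝 (W ^ 2 / (2 * θ))) := by
    have h1 : Tendsto (fun i => (W ^ 2 - (T i)⁻¹ * (T i * (W ^ 2 - 2 * θ * D i))) / (2 * θ)) l
        (𝓝 (W ^ 2 / (2 * θ))) := by
      simpa using ((hTinv.mul hc).const_sub (W ^ 2)).div_const (2 * θ)
    refine h1.congr' (hpos.mono fun i hi => ?_)
    field_simp
    ring
  have hD0 : W ^ 2 / (2 * θ) ≠ 0 := by positivity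
  have hDne : ∀ᶠ i in l, D i ≠ 0 := hDlim.eventually_ne hD0
  obtain ⟨B, hB⟩ : ∃ B : ι → ℝ, ∀ i, B i = 1 / 2 * (e i * X i) - (T i)⁻¹ * (e i * I₁ i) :=
    ⟨_, fun _ => rfl⟩
  have hBlim : Tendsto B l (𝓝 (W / 2)) := by
    rw [funext hB]
    have := (hx.const_mul (1 / 2)).sub (hTinv.mul hi1)
    simpa [div_eq_inv_mul] using this
  have hB0 : W / 2 ≠ 0 := by positivity
  have hBne : ∀ᶠ i in l, B i ≠ 0 := hBlim.eventually_ne hB0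
  have hepos : ∀ i, 0 < e i := fun i => he i ▸ Real.exp_pos _
  refine ⟨?_, ?_, ?_⟩
  -- The numerator of the error is T J − G I₁. After subtracting 2θξ/W, what remains over D W is
  -- ξ(W² − 2θD) + W(eJ − Wξ) − W (G/T)(e I₁).
  · have hξT : Tendsto (fun i => ξ i / T i ^ η * T i ^ (η - 1)) l (𝓝 0) := by
      simpa using hξ.mul hp1
    have hnum := (((hξT.mul hc).add (hJ.const_mul W)).sub ((hG.mul hi1).const_mul W)).div
      (hDlim.mul_const W) (mul_ne_zero hD0 hW)
    simp only [zero_mul, mul_zero, add_zero, sub_zero, zero_div] at hnum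
    refine hnum.congr' ?_
    filter_upwards [hpos, hDne] with i hi hDi
    have h1 : T i ^ (η - 1) = T i ^ η / T i := by rw [Real.rpow_sub hi, Real.rpow_one]
    have h2 : ξ i / T i ^ η * T i ^ (η - 1) = ξ i / T i := by
      rw [h1]
      have := (Real.rpow_pos_of_pos hi η).ne'
      field_simp
    have h3 : Real.exp (θ * T i) = (e i)⁻¹ := by
      rw [he, ← Real.exp_neg]; ring_nf
    have hGi : G i = X i - θ * (I₁ i + μ * T i) := by
      rw [hI₁ i]; field_simp; ring
    have hei := (hepos i).ne'
    have hDi' : T i * I₂ i - I₁ i ^ 2 ≠ 0 := by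
      intro h0
      apply hDi
      simp only [hD]
      have : I₂ i - I₁ i ^ 2 / T i = (T i * I₂ i - I₁ i ^ 2) / T i := by field_simp
      rw [this, h0]; simp
    have hDi2 : D i = e i ^ 2 * (T i * I₂ i - I₁ i ^ 2) / T i := by
      simp only [hD]; field_simp
    dsimp only [Pi.div_apply]
    rw [h2, h3, hGi, hDi2, hJdef]
    field_simp
    ring
  -- The error equals (X G/2 − J)/(θ(T X/2 − I₁)). Subtracting its leading term cancels X G/2 and
  -- leaves T^{-η}((G/T) e I₁ − e J)/(θB).
  · have hnum := (((hG.mul hp).mul hi1).sub hpJ).div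
      (hBlim.const_mul θ) (mul_ne_zero hθ.ne' hB0)
    simp only [zero_mul, mul_zero, sub_zero, zero_div] at hnum
    refine hnum.congr' ?_
    filter_upwards [hpos, hBne] with i hi hBi
    have hq := (Real.rpow_pos_of_pos hi η).ne'
    have h1 : T i ^ (1 - η) = T i / T i ^ η := by rw [Real.rpow_sub hi, Real.rpow_one]
    have hGi : G i = X i - θ * (I₁ i + μ * T i) := by
      rw [hI₁ i]; field_simp; ring
    have hei := (hepos i).ne'
    have hBi2 : B i = e i * (1 / 2 * T i * X i - I₁ i) / T i := by
      simp only [hB]; field_simp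
    have hBi' : 1 / 2 * T i * X i - I₁ i ≠ 0 := by
      intro h0
      apply hBi
      rw [hBi2, h0]; simp
    obtain ⟨Q, hQ⟩ : ∃ Q, 1 / 2 * T i * X i - I₁ i = Q := ⟨_, rfl⟩
    dsimp only [Pi.div_apply]
    rw [h1, hGi, hBi2, Real.rpow_neg hi.le, hJdef]
    rw [hQ] at hBi' ⊢
    field_simp
    rw [← hQ]
    ring
  -- The numerator is G I₂ − J I₁; subtracting G/T^η cancels the I₂ term and leaves T^{-η}((G/T)(e
  -- I₁)² − (e J)(e I₁))/D.
  · have hnum := (((hG.mul hp).mul (hi1.pow 2)).sub (hpJ.mul hi1)).div hDlim hD0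
    simp only [zero_mul, mul_zero, sub_zero, zero_div] at hnum
    refine hnum.congr' ?_
    filter_upwards [hpos, hDne] with i hi hDi
    have hq := (Real.rpow_pos_of_pos hi η).ne'
    have h1 : T i ^ (1 - η) = T i / T i ^ η := by rw [Real.rpow_sub hi, Real.rpow_one]
    have hGi : G i = X i - θ * (I₁ i + μ * T i) := by
      rw [hI₁ i]; field_simp; ring
    have hei := (hepos i).ne'
    have hDi2 : D i = e i ^ 2 * (T i * I₂ i - I₁ i ^ 2) / T i := by
      simp only [hD]; field_simp
    have hDi' : T i * I₂ i - I₁ i ^ 2 ≠ 0 := by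
      intro h0
      apply hDi
      rw [hDi2, h0]; simp
    dsimp only [Pi.div_apply]
    rw [h1, hGi, hDi2, Real.rpow_neg hi.le, hJdef]
    field_simp
    ring

end Estimators

/-! ### Convergence in law: mapping theorem and characteristic functions -/

section WeakConvergence

theorem aemeasurable_euclidean_triple {Ω : Type*} [MeasurableSpace Ω] {P : Measure Ω}
    {f g k : Ω → ℝ} (hf : AEMeasurable f P)
    (hg : AEMeasurable g P) (hk : AEMeasurable k P) :
    AEMeasurable (fun ω => !₂[f ω, g ω, k ω]) P := by
  refine (WithLp.measurable_toLp 2 (Fin 3 → ℝ)).comp_aemeasurable (aemeasurable_pi_lambda _ ?_)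
  intro j
  fin_cases j <;> assumption

theorem charFun_map_euclidean_triple {Ω : Type*} [MeasurableSpace Ω] {P : Measure Ω}
    {f g k : Ω → ℝ} (hf : AEMeasurable f P)
    (hg : AEMeasurable g P) (hk : AEMeasurable k P) (t : EuclideanSpace ℝ (Fin 3)) :
    charFun (P.map fun ω => !₂[f ω, g ω, k ω]) t =
      ∫ ω, Complex.exp ((t 0 * f ω + t 1 * g ω + t 2 * k ω : ℝ) * Complex.I) ∂P := by
  rw [charFun_apply, integral_map (aemeasurable_euclidean_triple hf hg hk)
    (Continuous.aestronglyMeasurable (by fun_prop))]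
  refine integral_congr_ae (ae_of_all _ fun ω => ?_)
  simp [PiLp.inner_apply, Fin.sum_univ_three]

variable {Ω Ω' ι : Type*} [MeasurableSpace Ω] [MeasurableSpace Ω'] {P : Measure Ω}
  [IsProbabilityMeasure P] {P' : Measure Ω'} [IsProbabilityMeasure P'] {l : Filter ι}
  [l.IsCountablyGenerated]

/-- The mapping theorem for maps that are continuous at almost all values of the limit. -/
theorem tendstoInDistribution_comp_of_ae_continuousAt {E F : Type*}
    [TopologicalSpace E] [MeasurableSpace E] [OpensMeasurableSpace E] [HasOuterApproxClosed E]
    [PseudoEMetricSpace F] [MeasurableSpace F] [BorelSpace F]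
    {X : ι → Ω → E} {Z : Ω' → E} {g : E → F} (hgm : Measurable g)
    (hg : ∀ᵐ ω ∂P', ContinuousAt g (Z ω))
    (h : TendstoInDistribution X l Z (fun _ => P) P') :
    TendstoInDistribution (fun i ω => g (X i ω)) l (fun ω => g (Z ω)) (fun _ => P) P' where
  forall_aemeasurable i := hgm.comp_aemeasurable (h.forall_aemeasurable i)
  aemeasurable_limit := hgm.comp_aemeasurable h.aemeasurable_limit
  tendsto := by
    refine tendsto_of_forall_isClosed_limsup_le' fun F hF => ?_
    have hZ := h.aemeasurable_limit
    -- Portmanteau is applied to the closure of g⁻¹(F): a continuity point of g in this closure is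
    -- already mapped into the closed set F.
    have hcl := ProbabilityMeasure.limsup_measure_closed_le_of_tendsto h.tendsto
      (isClosed_closure (s := g ⁻¹' F))
    simp only [ProbabilityMeasure.coe_mk] at hcl ⊢
    refine le_trans ?_ (hcl.trans ?_)
    · refine limsup_le_limsup (Eventually.of_forall fun i => ?_)
      have hX := h.forall_aemeasurable i
      dsimp only
      rw [Measure.map_apply_of_aemeasurable (f := fun ω => g (X i ω))
        (hgm.comp_aemeasurable hX) hF.measurableSet,
        Measure.map_apply_of_aemeasurable hX isClosed_closure.measurableSet]
      exact measure_mono fun ω hω => subset_closure hω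
    · rw [Measure.map_apply_of_aemeasurable hZ isClosed_closure.measurableSet,
        Measure.map_apply_of_aemeasurable (f := fun ω => g (Z ω))
          (hgm.comp_aemeasurable hZ) hF.measurableSet]
      refine measure_mono_ae ?_
      filter_upwards [hg] with ω hω hmem
      exact hF.closure_subset (hω.continuousWithinAt.mem_closure hmem (fun y hy => hy))

/-- Cramér-Wold device in dimension three. -/
theorem tendstoInDistribution_triple {A B C : ι → Ω → ℝ} {A' B' C' : Ω' → ℝ}
    (hA : ∀ i, AEMeasurable (A i) P) (hB : ∀ i, AEMeasurable (B i) P)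
    (hC : ∀ i, AEMeasurable (C i) P) (hA' : AEMeasurable A' P') (hB' : AEMeasurable B' P')
    (hC' : AEMeasurable C' P')
    (h : ∀ a b c : ℝ, Tendsto
      (fun i => ∫ ω, Complex.exp ((a * A i ω + b * B i ω + c * C i ω : ℝ) * Complex.I) ∂P) l
      (𝓝 (∫ ω, Complex.exp ((a * A' ω + b * B' ω + c * C' ω : ℝ) * Complex.I) ∂P'))) :
    TendstoInDistribution (fun i ω => (A i ω, B i ω, C i ω)) l (fun ω => (A' ω, B' ω, C' ω))
      (fun _ => P) P' := by
  have key : TendstoInDistribution (fun i ω => !₂[A i ω, B i ω, C i ω]) l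
      (fun ω => !₂[A' ω, B' ω, C' ω]) (fun _ => P) P' := by
    refine ⟨fun i => aemeasurable_euclidean_triple (hA i) (hB i) (hC i),
      aemeasurable_euclidean_triple hA' hB' hC', ?_⟩
    refine tendsto_of_seq_tendsto fun u hu => ?_
    refine ProbabilityMeasure.tendsto_of_tendsto_charFun fun t => ?_
    rw [ProbabilityMeasure.coe_mk, charFun_map_euclidean_triple hA' hB' hC']
    exact ((h (t 0) (t 1) (t 2)).comp hu).congr fun n =>
      (charFun_map_euclidean_triple (hA _) (hB _) (hC _) t).symm
  have := key.continuous_comp (g := fun x : EuclideanSpace ℝ (Fin 3) => (x 0, x 1, x 2))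
    (by fun_prop)
  simpa [Function.comp_def] using this

end WeakConvergence

/-! ### Gaussian spaces and their almost sure closures -/

section GaussianSpace

variable {Ω : Type*} [MeasurableSpace Ω] {P : Measure Ω}

theorem integral_exp_mul_I_of_hasLaw {Y : Ω → ℝ} {v : ℝ≥0} (h : HasLaw Y (gaussianReal 0 v) P)
    (t : ℝ) : ∫ ω, Complex.exp ((t * Y ω : ℝ) * Complex.I) ∂P =
      Complex.exp ((-(v * t ^ 2 / 2) : ℝ)) := by
  have := charFun_gaussianReal (μ := 0) (v := v) t
  rw [← h.map_eq, charFun_apply_real, integral_map h.aemeasurable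
    (Continuous.aestronglyMeasurable (by fun_prop))] at this
  push_cast
  rw [this]
  simp

theorem memLp_two_of_hasLaw {Y : Ω → ℝ} {v : ℝ≥0} (h : HasLaw Y (gaussianReal 0 v) P) :
    MemLp Y 2 P := by
  have := memLp_id_gaussianReal (μ := 0) (v := v) 2
  rw [← h.map_eq, memLp_map_measure_iff (by fun_prop) h.aemeasurable] at this
  exact this

theorem integral_sq_of_hasLaw {Y : Ω → ℝ} {v : ℝ≥0} (h : HasLaw Y (gaussianReal 0 v) P) :
    ∫ ω, Y ω ^ 2 ∂P = v := by
  have h1 := variance_id_gaussianReal (μ := 0) (v := v)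
  rw [variance_eq_integral (by fun_prop)] at h1
  simp only [id_eq, integral_id_gaussianReal, sub_zero] at h1
  rw [← h1, ← h.map_eq, integral_map h.aemeasurable
    (Continuous.aestronglyMeasurable (by fun_prop))]

/-- An almost sure limit of centered Gaussian variables is a centered Gaussian variable, and the
variances converge. -/
theorem exists_hasLaw_gaussianReal_of_tendsto_ae [IsProbabilityMeasure P] {y : ℕ → Ω → ℝ}
    {Y : Ω → ℝ} {v : ℕ → ℝ≥0} (hy : ∀ n, HasLaw (y n) (gaussianReal 0 (v n)) P)
    (h : ∀ᵐ ω ∂P, Tendsto (fun n => y n ω) atTop (𝓝 (Y ω))) :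
    ∃ w : ℝ≥0, HasLaw Y (gaussianReal 0 w) P ∧ Tendsto v atTop (𝓝 w) := by
  have hY : AEMeasurable Y P := aemeasurable_of_tendsto_metrizable_ae _
    (fun n => (hy n).aemeasurable) h
  have hprob : IsProbabilityMeasure (P.map Y) := Measure.isProbabilityMeasure_map hY
  have hlim : ∀ t : ℝ, Tendsto (fun n => Complex.exp ((-(v n * t ^ 2 / 2) : ℝ))) atTop
      (𝓝 (charFun (P.map Y) t)) := by
    intro t
    have h1 : charFun (P.map Y) t = ∫ ω, Complex.exp ((t * Y ω : ℝ) * Complex.I) ∂P := by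
      rw [charFun_apply_real, integral_map hY (Continuous.aestronglyMeasurable (by fun_prop))]
      simp
    rw [h1]
    simp only [← integral_exp_mul_I_of_hasLaw (hy _)]
    refine tendsto_integral_of_dominated_convergence (fun _ => 1) (fun n => ?_)
      (integrable_const _) (fun n => ae_of_all _ fun ω => ?_) ?_
    · have := (hy n).aemeasurable
      exact (by fun_prop : AEMeasurable _ P).aestronglyMeasurable
    · rw [Complex.norm_exp_ofReal_mul_I]
    · filter_upwards [h] with ω hω
      exact ((Complex.continuous_exp.comp (by fun_prop : Continuous fun x : ℝ =>
        ((t * x : ℝ) : ℂ) * Complex.I)).tendsto _).comp hω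
  -- The limiting characteristic function is nonzero at some t ≠ 0. There |φ_n(t)| = exp(−v_n t²/2),
  -- so taking logarithms forces the variances to converge.
  have hc : Tendsto (fun t : ℝ => ‖charFun (P.map Y) t‖) (𝓝[≠] 0) (𝓝 1) := by
    have := (continuous_charFun (μ := P.map Y)).norm.tendsto (0 : ℝ)
    simp only [charFun_zero, probReal_univ, Complex.ofReal_one, norm_one] at this
    exact this.mono_left nhdsWithin_le_nhds
  obtain ⟨t, ht, ht0⟩ := ((hc.eventually_const_lt one_half_lt_one).and
    self_mem_nhdsWithin).exists
  have ht0 : t ≠ 0 := ht0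
  have hr0 : ‖charFun (P.map Y) t‖ ≠ 0 := by
    intro h0; rw [h0] at ht; norm_num at ht
  have hv : Tendsto (fun n => (v n : ℝ)) atTop
      (𝓝 (-2 / t ^ 2 * Real.log ‖charFun (P.map Y) t‖)) := by
    have h1 := (((hlim t).norm).log hr0).const_mul (-2 / t ^ 2)
    refine h1.congr fun n => ?_
    rw [Complex.norm_exp, Complex.ofReal_re, Real.log_exp]
    field_simp
  have hw0 : 0 ≤ -2 / t ^ 2 * Real.log ‖charFun (P.map Y) t‖ :=
    ge_of_tendsto' hv fun n => (v n).2
  set w : ℝ≥0 := ⟨_, hw0⟩ with hw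
  refine ⟨w, ⟨hY, ?_⟩, NNReal.tendsto_coe.1 hv⟩
  refine Measure.ext_of_charFun (funext fun s => ?_)
  refine tendsto_nhds_unique (hlim s) ?_
  rw [charFun_gaussianReal]
  have h2 : (Complex.exp (s * (0 : ℝ) * Complex.I - w * s ^ 2 / 2)) =
      Complex.exp ((-((w : ℝ) * s ^ 2 / 2) : ℝ)) := by
    push_cast; simp
  rw [h2]
  have h3 : Continuous fun r : ℝ => Complex.exp ((-(r * s ^ 2 / 2) : ℝ)) := by fun_prop
  exact (h3.tendsto _).comp hv

/-- A space of centered Gaussian random variables. -/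
def IsGaussianSpace (S : Submodule ℝ (Ω → ℝ)) (P : Measure Ω) : Prop :=
  ∀ Y ∈ S, ∃ v : ℝ≥0, HasLaw Y (gaussianReal 0 v) P

/-- The almost sure limits of sequences in a space of random variables. -/
def aeClosure (S : Submodule ℝ (Ω → ℝ)) (P : Measure Ω) : Submodule ℝ (Ω → ℝ) where
  carrier := {Y | ∃ y : ℕ → Ω → ℝ, (∀ n, y n ∈ S) ∧
    ∀ᵐ ω ∂P, Tendsto (fun n => y n ω) atTop (𝓝 (Y ω))}
  add_mem' := by
    rintro Y Z ⟨y, hy, hyY⟩ ⟨z, hz, hzZ⟩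
    refine ⟨fun n => y n + z n, fun n => S.add_mem (hy n) (hz n), ?_⟩
    filter_upwards [hyY, hzZ] with ω h1 h2 using h1.add h2
  zero_mem' := ⟨fun _ => 0, fun _ => S.zero_mem, ae_of_all _ fun _ => tendsto_const_nhds⟩
  smul_mem' := by
    rintro c Y ⟨y, hy, hyY⟩
    refine ⟨fun n => c • y n, fun n => S.smul_mem c (hy n), ?_⟩
    filter_upwards [hyY] with ω h1 using h1.const_mul c

theorem le_aeClosure (S : Submodule ℝ (Ω → ℝ)) (P : Measure Ω) : S ≤ aeClosure S P :=
  fun Y hY => ⟨fun _ => Y, fun _ => hY, ae_of_all _ fun _ => tendsto_const_nhds⟩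

variable {S : Submodule ℝ (Ω → ℝ)}

theorem IsGaussianSpace.memLp_two (hS : IsGaussianSpace S P) {Y : Ω → ℝ} (hY : Y ∈ S) :
    MemLp Y 2 P := by
  obtain ⟨v, hv⟩ := hS Y hY
  exact memLp_two_of_hasLaw hv

theorem IsGaussianSpace.aeClosure [IsProbabilityMeasure P] (hS : IsGaussianSpace S P) :
    IsGaussianSpace (aeClosure S P) P := by
  rintro Y ⟨y, hy, hyY⟩
  choose v hv using fun n => hS (y n) (hy n)
  obtain ⟨w, hw, -⟩ := exists_hasLaw_gaussianReal_of_tendsto_ae hv hyY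
  exact ⟨w, hw⟩

/-- Almost sure convergence in a Gaussian space is convergence in mean square. -/
theorem IsGaussianSpace.tendsto_integral_sub_sq [IsProbabilityMeasure P]
    (hS : IsGaussianSpace S P) {y : ℕ → Ω → ℝ} {Y : Ω → ℝ} (hy : ∀ n, y n ∈ S) (hY : Y ∈ S)
    (h : ∀ᵐ ω ∂P, Tendsto (fun n => y n ω) atTop (𝓝 (Y ω))) :
    Tendsto (fun n => ∫ ω, (Y ω - y n ω) ^ 2 ∂P) atTop (𝓝 0) := by
  -- The differences are centered Gaussian and tend to 0 almost surely, so their variances tend to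
  -- the variance of the zero variable.
  choose v hv using fun n => hS (Y - y n) (S.sub_mem hY (hy n))
  obtain ⟨w, hw, hlim⟩ := exists_hasLaw_gaussianReal_of_tendsto_ae (Y := 0) hv (by
    filter_upwards [h] with ω hω
    simpa using hω.const_sub (Y ω))
  have hw0 : (w : ℝ) = 0 := by
    rw [← integral_sq_of_hasLaw hw]; simp
  have : ∀ n, ∫ ω, (Y ω - y n ω) ^ 2 ∂P = v n := fun n => integral_sq_of_hasLaw (hv n)
  simp only [this]
  rw [← hw0]
  exact NNReal.tendsto_coe.2 hlim

/-- Asymptotic orthogonality to a Gaussian space extends to its closure. -/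
theorem IsGaussianSpace.tendsto_integral_mul_aeClosure [IsProbabilityMeasure P]
    (hS : IsGaussianSpace S P) {ι : Type*} {l : Filter ι} {A : ι → Ω → ℝ}
    (hA : ∀ i, MemLp (A i) 2 P) {C : ℝ} (hC : ∀ᶠ i in l, ∫ ω, A i ω ^ 2 ∂P ≤ C)
    (h : ∀ Y ∈ S, Tendsto (fun i => ∫ ω, Y ω * A i ω ∂P) l (𝓝 0)) :
    ∀ Y ∈ Vasicek.aeClosure S P, Tendsto (fun i => ∫ ω, Y ω * A i ω ∂P) l (𝓝 0) := by
  intro Y hY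
  obtain ⟨y, hy, hyY⟩ := id hY
  have hS' := hS.aeClosure
  have hlim := hS'.tendsto_integral_sub_sq (fun n => le_aeClosure S P (hy n)) hY hyY
  rw [Metric.tendsto_nhds]
  intro ε hε
  -- δ is the weight in |uv| ≤ u²/(2δ) + δv²/2. It makes the A² term at most ε/4, and a mean square
  -- error below εδ makes the other at most ε/2.
  set δ : ℝ := ε / (2 * (|C| + 1)) with hδ
  have hδ0 : 0 < δ := by positivity
  obtain ⟨n, hn⟩ := (hlim.eventually_lt_const (mul_pos hε hδ0)).exists
  have h1 := (Metric.tendsto_nhds.1 (h (y n) (hy n))) (ε / 4) (by positivity)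
  filter_upwards [hC, h1] with i hCi h1i
  have m1 := hS'.memLp_two hY
  have m2 := hS.memLp_two (hy n)
  have i1 : Integrable (fun ω => (Y ω - y n ω) * A i ω) P := (m1.sub m2).integrable_mul (hA i)
  have i2 : Integrable (fun ω => y n ω * A i ω) P := m2.integrable_mul (hA i)
  have hsplit : ∫ ω, Y ω * A i ω ∂P =
      ∫ ω, (Y ω - y n ω) * A i ω ∂P + ∫ ω, y n ω * A i ω ∂P := by
    rw [← integral_add i1 i2]
    congr 1; ext ω; ring
  have hb : |∫ ω, (Y ω - y n ω) * A i ω ∂P| ≤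
      1 / (2 * δ) * ∫ ω, (Y ω - y n ω) ^ 2 ∂P + δ / 2 * ∫ ω, A i ω ^ 2 ∂P := by
    have j1 : Integrable (fun ω => (Y ω - y n ω) ^ 2) P := (m1.sub m2).integrable_sq
    have j2 : Integrable (fun ω => A i ω ^ 2) P := (hA i).integrable_sq
    rw [← integral_const_mul, ← integral_const_mul, ← integral_add (j1.const_mul _)
      (j2.const_mul _)]
    refine (abs_integral_le_integral_abs).trans (integral_mono i1.abs
      ((j1.const_mul _).add (j2.const_mul _)) fun ω => ?_)
    dsimp only
    rw [abs_mul]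
    rw [← sq_abs (Y ω - y n ω), ← sq_abs (A i ω)]
    have e : 1 / (2 * δ) * |Y ω - y n ω| ^ 2 + δ / 2 * |A i ω| ^ 2 - |Y ω - y n ω| * |A i ω| =
        (|Y ω - y n ω| - δ * |A i ω|) ^ 2 / (2 * δ) := by field_simp; ring
    have : 0 ≤ (|Y ω - y n ω| - δ * |A i ω|) ^ 2 / (2 * δ) := by positivity
    linarith
  have hb1 : 1 / (2 * δ) * ∫ ω, (Y ω - y n ω) ^ 2 ∂P ≤ ε / 2 := by
    calc _ ≤ 1 / (2 * δ) * (ε * δ) := by gcongr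
      _ = ε / 2 := by field_simp
  have hb2 : δ / 2 * ∫ ω, A i ω ^ 2 ∂P ≤ ε / 4 := by
    calc _ ≤ δ / 2 * (|C| + 1) := by
          gcongr
          linarith [le_abs_self C]
      _ = ε / 4 := by rw [hδ]; field_simp; norm_num
  rw [Real.dist_eq, sub_zero] at h1i ⊢
  rw [hsplit]
  refine (abs_add_le _ _).trans_lt ?_
  linarith

theorem tendsto_integral_mul_span {G : ℝ≥0 → Ω → ℝ}
    (hS : IsGaussianSpace (Submodule.span ℝ (Set.range G)) P)
    {ι : Type*} {l : Filter ι} {A : ι → Ω → ℝ} (hA : ∀ i, MemLp (A i) 2 P)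
    (h : ∀ s, Tendsto (fun i => ∫ ω, G s ω * A i ω ∂P) l (𝓝 0)) :
    ∀ Y ∈ Submodule.span ℝ (Set.range G), Tendsto (fun i => ∫ ω, Y ω * A i ω ∂P) l (𝓝 0) := by
  intro Y hY
  induction hY using Submodule.span_induction with
  | mem x hx => obtain ⟨s, rfl⟩ := hx; exact h s
  | zero => simpa using tendsto_const_nhds
  | add x y hx hy ihx ihy =>
    have := ihx.add ihy
    rw [add_zero] at this
    refine this.congr fun i => ?_
    have i1 : Integrable (fun ω => x ω * A i ω) P := (hS.memLp_two hx).integrable_mul (hA i)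
    have i2 : Integrable (fun ω => y ω * A i ω) P := (hS.memLp_two hy).integrable_mul (hA i)
    rw [← integral_add i1 i2]
    congr 1; ext ω; simp [add_mul]
  | smul c x hx ih =>
    have := ih.const_mul c
    rw [mul_zero] at this
    refine this.congr fun i => ?_
    rw [← integral_const_mul]
    congr 1; ext ω; simp [mul_assoc]

theorem IsCenteredGaussian.isGaussianSpace {G : ℝ≥0 → Ω → ℝ} (hG : IsCenteredGaussian G P) :
    IsGaussianSpace (Submodule.span ℝ (Set.range G)) P := by
  intro Y hY
  obtain ⟨c, rfl⟩ := Finsupp.mem_span_range_iff_exists_finsupp.1 hY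
  have hint : ∀ t, Integrable (G t) P := fun t => (hG.gaussian.hasGaussianLaw_eval t).integrable
  have h1 := (hG.gaussian.smul c).hasGaussianLaw_sum (I := c.support)
  have h2 : (∑ t ∈ c.support, fun ω => c t • G t ω) = c.sum fun i a => a • G i := by
    rw [Finsupp.sum]; rfl
  rw [h2] at h1
  refine ⟨Var[c.sum fun i a => a • G i; P].toNNReal, h1.aemeasurable, ?_⟩
  rw [h1.map_eq_gaussianReal]
  congr 1
  have h3 : (c.sum fun i a => a • G i) = fun ω => ∑ t ∈ c.support, c t * G t ω := by
    ext ω; simp [Finsupp.sum]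
  rw [h3, integral_finsetSum _ fun t _ => (hint t).const_mul _]
  simp [integral_const_mul, hG.centered]

/-- Asymptotically orthogonal elements of a Gaussian space are asymptotically independent. -/
theorem IsGaussianSpace.tendstoInDistribution_triple [IsProbabilityMeasure P]
    (hS : IsGaussianSpace S P) {ι : Type*} {l : Filter ι} [l.IsCountablyGenerated]
    {A B : ι → Ω → ℝ} {H : Ω → ℝ} {a₀ b₀ : ℝ} (hA : ∀ i, A i ∈ S) (hB : ∀ i, B i ∈ S) (hH : H ∈ S)
    (hAA : Tendsto (fun i => ∫ ω, A i ω ^ 2 ∂P) l (𝓝 (a₀ ^ 2)))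
    (hBB : Tendsto (fun i => ∫ ω, B i ω ^ 2 ∂P) l (𝓝 (b₀ ^ 2)))
    (hAB : Tendsto (fun i => ∫ ω, A i ω * B i ω ∂P) l (𝓝 0))
    (hHA : Tendsto (fun i => ∫ ω, H ω * A i ω ∂P) l (𝓝 0))
    (hHB : Tendsto (fun i => ∫ ω, H ω * B i ω ∂P) l (𝓝 0))
    {N₁ N₂ : Ω → ℝ} (hN₁ : HasLaw N₁ (gaussianReal 0 1) P) (hN₂ : HasLaw N₂ (gaussianReal 0 1) P)
    (hN : IndepFun N₁ N₂ P) (hNH : IndepFun (fun ω => (N₁ ω, N₂ ω)) H P) :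
    TendstoInDistribution (fun i ω => (A i ω, B i ω, H ω)) l
      (fun ω => (a₀ * N₂ ω, b₀ * N₁ ω, H ω)) (fun _ => P) P := by
  have mA := fun i => hS.memLp_two (hA i)
  have mB := fun i => hS.memLp_two (hB i)
  have mH := hS.memLp_two hH
  have m₁ := hN₁.aemeasurable
  have m₂ := hN₂.aemeasurable
  refine Vasicek.tendstoInDistribution_triple (fun i => (mA i).aemeasurable)
    (fun i => (mB i).aemeasurable) (fun _ => mH.aemeasurable) (m₂.const_mul a₀) (m₁.const_mul b₀)
    mH.aemeasurable fun a b c => ?_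
  -- Each linear combination is centered Gaussian, and so is its limit by independence, so only the
  -- variances have to converge.
  choose v hv using fun i => hS (a • A i + b • B i + c • H)
    (S.add_mem (S.add_mem (S.smul_mem a (hA i)) (S.smul_mem b (hB i))) (S.smul_mem c hH))
  obtain ⟨w, hw⟩ := hS (c • H) (S.smul_mem c hH)
  have hlim : ∃ u : ℝ≥0, (u : ℝ) = a ^ 2 * a₀ ^ 2 + b ^ 2 * b₀ ^ 2 + w ∧
      HasLaw (fun ω => a * (a₀ * N₂ ω) + b * (b₀ * N₁ ω) + c * H ω) (gaussianReal 0 u) P := by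
    have e1 := gaussianReal_const_mul hN₂ (a * a₀)
    have e2 := gaussianReal_const_mul hN₁ (b * b₀)
    have i1 : IndepFun (fun ω => a * a₀ * N₂ ω) (fun ω => b * b₀ * N₁ ω) P :=
      hN.symm.comp (measurable_const_mul (a * a₀)) (measurable_const_mul (b * b₀))
    have i2 : IndepFun (fun ω => a * a₀ * N₂ ω + b * b₀ * N₁ ω) (c • H) P :=
      hNH.comp (φ := fun p : ℝ × ℝ => a * a₀ * p.2 + b * b₀ * p.1) (ψ := fun x => c • x)
        (by fun_prop) (by fun_prop)
    have e3 := gaussianReal_add_gaussianReal_of_indepFun i1 e1.map_eq e2.map_eq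
    have e4 : HasLaw _ _ P := ⟨(by have := mH.aemeasurable.const_smul c; fun_prop),
      gaussianReal_add_gaussianReal_of_indepFun i2 e3 hw.map_eq⟩
    simp only [mul_zero, add_zero] at e4
    refine ⟨_, ?_, e4.congr (ae_of_all _ fun ω => ?_)⟩
    · push_cast
      simp
      ring
    · simp
      ring
  obtain ⟨u, hu, hlaw⟩ := hlim
  have e1 : ∀ i, ∫ ω, Complex.exp ((a * A i ω + b * B i ω + c * H ω : ℝ) * Complex.I) ∂P =
      Complex.exp ((-((v i : ℝ) / 2) : ℝ)) := fun i => by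
    simpa using integral_exp_mul_I_of_hasLaw (hv i) 1
  have e2 : ∫ ω, Complex.exp ((a * (a₀ * N₂ ω) + b * (b₀ * N₁ ω) + c * H ω : ℝ) * Complex.I) ∂P =
      Complex.exp ((-((u : ℝ) / 2) : ℝ)) := by
    simpa using integral_exp_mul_I_of_hasLaw hlaw 1
  simp only [e1, e2]
  have hvu : Tendsto (fun i => (v i : ℝ)) l (𝓝 u) := by
    have hvar : ∀ i, (v i : ℝ) = a ^ 2 * ∫ ω, A i ω ^ 2 ∂P + b ^ 2 * ∫ ω, B i ω ^ 2 ∂P + w +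
        2 * a * b * ∫ ω, A i ω * B i ω ∂P + 2 * a * c * ∫ ω, H ω * A i ω ∂P +
        2 * b * c * ∫ ω, H ω * B i ω ∂P := by
      intro i
      rw [← integral_sq_of_hasLaw (hv i), ← integral_sq_of_hasLaw hw]
      have j1 := (mA i).integrable_sq
      have j2 := (mB i).integrable_sq
      have j3 : Integrable (fun ω => (c • H) ω ^ 2) P := (mH.const_smul c).integrable_sq
      have j4 : Integrable (fun ω => A i ω * B i ω) P := (mA i).integrable_mul (mB i)
      have j5 : Integrable (fun ω => H ω * A i ω) P := mH.integrable_mul (mA i)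
      have j6 : Integrable (fun ω => H ω * B i ω) P := mH.integrable_mul (mB i)
      simp only [← integral_const_mul]
      rw [← integral_add (j1.const_mul _) (j2.const_mul _), ← integral_add _ j3,
        ← integral_add _ (j4.const_mul _), ← integral_add _ (j5.const_mul _),
        ← integral_add _ (j6.const_mul _)]
      · congr 1; ext ω; simp; ring
      all_goals fun_prop
    simp only [hvar]
    have := ((((((hAA.const_mul (a ^ 2)).add (hBB.const_mul (b ^ 2))).add_const (w : ℝ)).add
      (hAB.const_mul (2 * a * b))).add (hHA.const_mul (2 * a * c))).add
      (hHB.const_mul (2 * b * c)))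
    rw [hu]
    simpa using this
  have hcont : Continuous fun r : ℝ => Complex.exp ((-(r / 2) : ℝ)) := by fun_prop
  exact (hcont.tendsto _).comp hvu

end GaussianSpace

/-! ### Measurability of path functionals -/

section Measurability

variable {Ω : Type*} [MeasurableSpace Ω] {Y : ℝ≥0 → Ω → ℝ}

theorem measurable_path_prod (hY : ∀ t, Measurable (Y t)) (hc : ∀ ω, Continuous fun t => Y t ω) :
    Measurable fun p : Ω × ℝ => Y p.2.toNNReal p.1 := by
  have : Measurable (Function.uncurry fun (s : ℝ) ω => Y s.toNNReal ω) :=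
    measurable_uncurry_of_continuous_of_measurable
      (fun ω => (hc ω).comp continuous_real_toNNReal) fun s => hY _
  exact this.comp measurable_swap

theorem measurable_integral_path (hY : ∀ t, Measurable (Y t))
    (hc : ∀ ω, Continuous fun t => Y t ω) {f : ℝ → ℝ} (hf : Measurable f) (k : ℕ)
    (ν : Measure ℝ) [SFinite ν] :
    Measurable fun ω => ∫ s, f s * Y s.toNNReal ω ^ k ∂ν := by
  have hm : Measurable fun p : Ω × ℝ => f p.2 * Y p.2.toNNReal p.1 ^ k :=
    (hf.comp measurable_snd).mul ((measurable_path_prod hY hc).pow_const k)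
  exact (hm.stronglyMeasurable.integral_prod_right' (ν := ν)).measurable

theorem measurable_timeIntegral_pow (hY : ∀ t, Measurable (Y t))
    (hc : ∀ ω, Continuous fun t => Y t ω) (k : ℕ) (T : ℝ≥0) :
    Measurable fun ω => timeIntegral (fun s => Y s ω ^ k) T := by
  simp only [timeIntegral, intervalIntegral.integral_of_le T.coe_nonneg]
  simpa using measurable_integral_path hY hc (f := fun _ => 1) measurable_const k
    (volume.restrict (Set.Ioc 0 (T : ℝ)))

theorem measurable_timeIntegral (hY : ∀ t, Measurable (Y t))
    (hc : ∀ ω, Continuous fun t => Y t ω) (T : ℝ≥0) :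
    Measurable fun ω => timeIntegral (fun s => Y s ω) T := by
  simpa using measurable_timeIntegral_pow hY hc 1 T

theorem measurable_zetaInfty (θ : ℝ) (hY : ∀ t, Measurable (Y t))
    (hc : ∀ ω, Continuous fun t => Y t ω) : Measurable (zetaInfty θ Y) := by
  have := (measurable_integral_path hY hc (f := fun s => Real.exp (-θ * s)) (by fun_prop) 1
    (volume.restrict (Set.Ioi 0))).const_mul θ
  simp only [pow_one] at this
  exact this

theorem measurable_discountedPath (θ μ : ℝ) (hY : ∀ t, Measurable (Y t))
    (hc : ∀ ω, Continuous fun t => Y t ω) {T : ℝ} (hT : 0 ≤ T) :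
    Measurable fun ω => discountedPath θ μ (fun s => Y s.toNNReal ω) T := by
  have := ((measurable_integral_path hY hc (f := fun s => Real.exp (-θ * s)) (by fun_prop) 1
    (volume.restrict (Set.Ioc 0 T))).const_mul θ).const_add μ
  simpa [discountedPath, intervalIntegral.integral_of_le hT] using this

end Measurability

/-! ### The solution and the noise as functionals of the Gaussian path -/

section Solution

variable {Ω : Type*} {θ μ : ℝ} {G X : ℝ≥0 → Ω → ℝ}

theorem IsSolution.real_equation (hX : IsSolution θ μ G X) (ω : Ω) {t : ℝ} (ht : 0 ≤ t) :
    X t.toNNReal ω = (∫ s in (0 : ℝ)..t, θ * (μ + X s.toNNReal ω)) +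
      (G t.toNNReal ω - G 0 ω) := by
  have := hX.equation ω t.toNNReal
  rwa [timeIntegral, Real.coe_toNNReal t ht] at this

/-- `IsSolution` says nothing about measurability of X; it comes from the explicit formula in terms
of G. -/
theorem IsSolution.measurable [MeasurableSpace Ω] (hX : IsSolution θ μ G X)
    (hG : ∀ t, Measurable (G t)) (hc : ∀ ω, Continuous fun t => G t ω) (t : ℝ≥0) :
    Measurable (X t) := by
  have h : X t = fun ω => Real.exp (θ * t) *
      discountedPath θ μ (fun s => G s.toNNReal ω - G 0 ω) t - μ + (G t ω - G 0 ω) := by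
    ext ω
    have := solution_eq (g := fun s => G s.toNNReal ω - G 0 ω) (x := fun s => X s.toNNReal ω)
      (((hc ω).comp continuous_real_toNNReal).sub continuous_const)
      ((hX.continuous ω).comp continuous_real_toNNReal)
      (fun s hs => hX.real_equation ω hs) t.2
    simpa using this
  rw [h]
  exact (((measurable_discountedPath θ μ (Y := fun s ω => G s ω - G 0 ω)
    (fun s => (hG s).sub (hG 0)) (fun ω => (hc ω).sub continuous_const) t.2).const_mul _).sub_const
    _).add ((hG t).sub (hG 0))

theorem expNoise_eq_noisePath (θ : ℝ) {ω : Ω} (hc : Continuous fun t => G t ω) (h0 : G 0 ω = 0)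
    (T : ℝ≥0) : expNoise θ G T ω = noisePath θ (fun s => G s.toNNReal ω) T := by
  rw [expNoise, (isYoungIntegral_exp θ hc T).youngIntegral_eq, noisePath, h0]
  have := exp_neg_mul_self θ T
  simp only [Real.toNNReal_coe]
  linear_combination (G T ω) * this

end Solution

/-! ### Membership in the Gaussian closure, and convergence in probability -/

section Limits

variable {Ω : Type*} [MeasurableSpace Ω] {P : Measure Ω} {θ : ℝ} {G : ℝ≥0 → Ω → ℝ}

/-- The uniform Riemann-Stieltjes sums are finite combinations of the G_t and converge on every
path. -/
theorem youngIntegral_exp_mem_aeClosure (a : ℝ) (hc : ∀ ω, Continuous fun t => G t ω) (T : ℝ≥0) :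
    (fun ω => youngIntegral (fun s => Real.exp (a * s)) (fun s => G s ω) T) ∈
      aeClosure (Submodule.span ℝ (Set.range G)) P := by
  refine ⟨fun n => ∑ i ∈ Finset.range (n + 1),
    Real.exp (a * ((T * i / (n + 1) : ℝ≥0) : ℝ)) •
      (G (T * (i + 1 : ℕ) / (n + 1)) - G (T * i / (n + 1))), fun n => ?_, ae_of_all _ fun ω => ?_⟩
  · refine Submodule.sum_mem _ fun i _ => Submodule.smul_mem _ _ (Submodule.sub_mem _ ?_ ?_) <;>
      exact Submodule.subset_span ⟨_, rfl⟩
  · have h := isYoungIntegral_exp a (hc ω) T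
    dsimp only
    rw [h.youngIntegral_eq]
    refine h.tendsto_uniform.congr fun n => ?_
    simp [Finset.sum_apply]

theorem expNoise_mem_aeClosure (θ : ℝ) (hc : ∀ ω, Continuous fun t => G t ω) (T : ℝ≥0) :
    expNoise θ G T ∈ aeClosure (Submodule.span ℝ (Set.range G)) P :=
  Submodule.smul_mem _ (Real.exp (-θ * T)) (youngIntegral_exp_mem_aeClosure θ hc T)

/-- By parts, θ∫₀ⁿ e^{-θs} G_s ds is a Young integral plus multiples of G_n and G_0, hence in the
first closure; letting n → ∞ costs a second closure, which avoids a diagonal extraction. -/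
theorem zetaInfty_mem_aeClosure (hc : ∀ ω, Continuous fun t => G t ω)
    (hint : ∀ᵐ ω ∂P, IntegrableOn (fun s => Real.exp (-θ * s) * G s.toNNReal ω) (Set.Ioi 0)) :
    zetaInfty θ G ∈ aeClosure (aeClosure (Submodule.span ℝ (Set.range G)) P) P := by
  set S := Submodule.span ℝ (Set.range G) with hS
  have hGS : ∀ t, G t ∈ aeClosure S P := fun t =>
    le_aeClosure S P (Submodule.subset_span ⟨t, rfl⟩)
  refine ⟨fun n ω => θ * ∫ s in (0 : ℝ)..(n : ℝ), Real.exp (-θ * s) * G s.toNNReal ω,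
    fun n => ?_, ?_⟩
  · have h : (fun ω => θ * ∫ s in (0 : ℝ)..(n : ℝ), Real.exp (-θ * s) * G s.toNNReal ω) =
        (fun ω => youngIntegral (fun s => Real.exp (-θ * s)) (fun s => G s ω) n) -
          Real.exp (-θ * n) • G n + G 0 := by
      ext ω
      simp only [Pi.add_apply, Pi.sub_apply, Pi.smul_apply, smul_eq_mul]
      rw [(isYoungIntegral_exp (-θ) (hc ω) n).youngIntegral_eq]
      push_cast
      ring
    dsimp only
    rw [h]
    exact Submodule.add_mem _ (Submodule.sub_mem _ (youngIntegral_exp_mem_aeClosure _ hc _)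
      (Submodule.smul_mem _ _ (hGS _))) (hGS 0)
  · filter_upwards [hint] with ω hω
    exact (intervalIntegral_tendsto_integral_Ioi 0 hω tendsto_natCast_atTop_atTop).const_mul θ

theorem IsCenteredGaussian.memLp_two (hG : IsCenteredGaussian G P) (t : ℝ≥0) :
    MemLp (G t) 2 P :=
  (hG.gaussian.hasGaussianLaw_eval t).memLp_two

/-- Fubini: taking s = 0 in the increment bound gives E[G_t²] ≤ c t^{2γ}, which is integrable
against e^{-θt/2}. -/
theorem ae_integrableOn_exp_mul_sq [IsProbabilityMeasure P] (hθ : 0 < θ)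
    (hG : IsCenteredGaussian G P) (hA1 : AssumptionA1 G P) :
    ∀ᵐ ω ∂P, IntegrableOn (fun s => Real.exp (-(θ / 2) * s) * G s.toNNReal ω ^ 2)
      (Set.Ioi 0) := by
  obtain ⟨h0, c, γ, hc, hγ, -, hcov⟩ := hA1
  have hvar : ∀ t : ℝ≥0, ∫ ω, G t ω ^ 2 ∂P ≤ c * (t : ℝ) ^ (2 * γ) := by
    intro t
    have h1 := hcov 0 t
    rw [NNReal.coe_zero, sub_zero, abs_of_nonneg t.coe_nonneg] at h1
    refine le_trans (le_of_eq (integral_congr_ae ?_)) h1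
    filter_upwards [h0] with ω hω
    rw [hω, sub_zero]
  have hm : Measurable fun p : Ω × ℝ => Real.exp (-(θ / 2) * p.2) * G p.2.toNNReal p.1 ^ 2 :=
    (by fun_prop : Measurable fun p : Ω × ℝ => Real.exp (-(θ / 2) * p.2)).mul
      ((measurable_path_prod hG.measurable hG.continuous).pow_const 2)
  have hint : Integrable (fun p : Ω × ℝ => Real.exp (-(θ / 2) * p.2) * G p.2.toNNReal p.1 ^ 2)
      (P.prod (volume.restrict (Set.Ioi 0))) := by
    rw [integrable_prod_iff' hm.aestronglyMeasurable]
    refine ⟨ae_of_all _ fun s =>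
      ((hG.memLp_two s.toNNReal).integrable_sq).const_mul (Real.exp (-(θ / 2) * s)), ?_⟩
    have hdom : Integrable (fun s : ℝ => c * (s ^ (2 * γ) * Real.exp (-(θ / 2) * s ^ (1 : ℝ))))
        (volume.restrict (Set.Ioi 0)) :=
      (integrableOn_rpow_mul_exp_neg_mul_rpow (by linarith) one_pos (half_pos hθ)).const_mul c
    refine hdom.mono' ?_ ?_
    · exact (hm.norm.stronglyMeasurable.integral_prod_left' (μ := P)).aestronglyMeasurable
    · refine (ae_restrict_iff' measurableSet_Ioi).2 (ae_of_all _ fun s hs => ?_)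
      have hs : 0 < s := hs
      rw [Real.norm_of_nonneg (integral_nonneg fun _ => norm_nonneg _)]
      have h1 : ∀ ω, ‖Real.exp (-(θ / 2) * s) * G s.toNNReal ω ^ 2‖ =
          Real.exp (-(θ / 2) * s) * G s.toNNReal ω ^ 2 := fun ω =>
        Real.norm_of_nonneg (by positivity)
      simp only [h1]
      rw [integral_const_mul, Real.rpow_one]
      have h2 := hvar s.toNNReal
      rw [Real.coe_toNNReal s hs.le] at h2
      calc _ ≤ Real.exp (-(θ / 2) * s) * (c * s ^ (2 * γ)) := by gcongr
        _ = _ := by ring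
  exact hint.prod_right_ae

/-- Convergence to zero in mean square implies convergence in probability. -/
theorem tendstoInMeasure_of_tendsto_integral_sq [IsFiniteMeasure P] {ι : Type*} {l : Filter ι}
    {Y : ι → Ω → ℝ} (hY : ∀ i, MemLp (Y i) 2 P)
    (h : Tendsto (fun i => ∫ ω, Y i ω ^ 2 ∂P) l (𝓝 0)) : TendstoInMeasure P Y l 0 := by
  rw [tendstoInMeasure_iff_measureReal_norm]
  intro ε hε
  have h1 := h.div_const (ε ^ 2)
  rw [zero_div] at h1
  refine squeeze_zero (fun i => measureReal_nonneg) (fun i => ?_) h1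
  rw [le_div_iff₀ (by positivity), mul_comm]
  refine le_trans (le_of_eq ?_) (mul_meas_ge_le_integral_of_nonneg
    (ae_of_all _ fun ω => sq_nonneg (Y i ω)) (hY i).integrable_sq (ε ^ 2))
  congr 2
  ext ω
  simp only [Set.mem_ofPred_eq, Pi.zero_apply, sub_zero, Real.norm_eq_abs]
  rw [← sq_abs (Y i ω), sq_le_sq₀ hε.le (abs_nonneg _)]

/-- Convergence in probability of a functional follows from almost sure convergence along all
sequences on which two controlling families, which tend to zero in probability, tend to zero. -/
theorem tendstoInMeasure_of_ae_tendsto_seq [IsFiniteMeasure P] {ι E : Type*} {l : Filter ι}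
    [l.IsCountablyGenerated] [SeminormedAddCommGroup E] {R₁ R₂ : ι → Ω → ℝ} {F : ι → Ω → E}
    (h₁ : TendstoInMeasure P R₁ l 0) (h₂ : TendstoInMeasure P R₂ l 0)
    (hF : ∀ i, AEStronglyMeasurable (F i) P)
    (h : ∀ᵐ ω ∂P, ∀ u : ℕ → ι, Tendsto u atTop l →
      Tendsto (fun n => R₁ (u n) ω) atTop (𝓝 0) → Tendsto (fun n => R₂ (u n) ω) atTop (𝓝 0) →
      Tendsto (fun n => F (u n) ω) atTop (𝓝 0)) : TendstoInMeasure P F l 0 := by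
  intro ε hε
  refine tendsto_of_seq_tendsto fun u hu => ?_
  have key : TendstoInMeasure P (fun n => F (u n)) atTop 0 := by
    -- Subsequence criterion: two successive extractions make both controlling families converge
    -- almost surely along one common subsequence.
    rw [exists_seq_tendstoInMeasure_atTop_iff fun n => hF _]
    intro ns hns
    have hu1 := hu.comp hns.tendsto_atTop
    obtain ⟨m₁, hm₁, hm₁'⟩ := (h₁.comp hu1).exists_seq_tendsto_ae
    obtain ⟨m₂, hm₂, hm₂'⟩ := (h₂.comp (hu1.comp hm₁.tendsto_atTop)).exists_seq_tendsto_ae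
    refine ⟨m₁ ∘ m₂, hm₁.comp hm₂, ?_⟩
    filter_upwards [hm₁', hm₂', h] with ω e₁ e₂ e
    exact e (fun n => u (ns (m₁ (m₂ n))))
      (hu1.comp (hm₁.tendsto_atTop.comp hm₂.tendsto_atTop))
      (e₁.comp hm₂.tendsto_atTop) e₂
  exact key ε hε

end Limits

/-! ### Probabilistic inputs for the pathwise estimates -/

section Convergence

variable {Ω : Type*} {θ μ η : ℝ} {G X : ℝ≥0 → Ω → ℝ}

/-- Asymptotics of the estimators along a path on which the limit is nondegenerate. -/
theorem IsSolution.tendsto_estimators (hX : IsSolution θ μ G X) (hθ : 0 < θ) (hη : 0 < η)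
    (hη1 : η < 1) {ω : Ω} (hc : Continuous fun t => G t ω) (h0 : G 0 ω = 0)
    (hK : IntegrableOn (fun s => Real.exp (-(θ / 2) * s) * G s.toNNReal ω ^ 2) (Set.Ioi 0))
    (hW : μ + zetaInfty θ G ω ≠ 0) {u : ℕ → ℝ≥0} (hu : Tendsto u atTop atTop)
    (hGu : Tendsto (fun n => G (u n) ω / (u n : ℝ)) atTop (𝓝 0))
    (hξu : Tendsto (fun n => expNoise θ G (u n) ω / (u n : ℝ) ^ η) atTop (𝓝 0)) :
    Tendsto (fun n => Real.exp (θ * u n) * (thetaTilde (fun s => X s ω) (u n) - θ) -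
      2 * θ * expNoise θ G (u n) ω / (μ + zetaInfty θ G ω)) atTop (𝓝 0) ∧
    Tendsto (fun n => (u n : ℝ) ^ (1 - η) * (muTilde (fun s => X s ω) (u n) - μ) -
      G (u n) ω / (u n : ℝ) ^ η / θ) atTop (𝓝 0) ∧
    Tendsto (fun n => (u n : ℝ) ^ (1 - η) * (alphaTilde (fun s => X s ω) (u n) - θ * μ) -
      G (u n) ω / (u n : ℝ) ^ η) atTop (𝓝 0) := by
  obtain ⟨W, hWdef⟩ : ∃ W, W = μ + zetaInfty θ G ω := ⟨_, rfl⟩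
  obtain ⟨g, hg⟩ : ∃ g : ℝ → ℝ, g = fun s => G s.toNNReal ω := ⟨_, rfl⟩
  obtain ⟨x, hx⟩ : ∃ x : ℝ → ℝ, x = fun s => X s.toNNReal ω := ⟨_, rfl⟩
  have hgc : Continuous g := by rw [hg]; exact hc.comp continuous_real_toNNReal
  have hxc : Continuous x := by rw [hx]; exact (hX.continuous ω).comp continuous_real_toNNReal
  have heq : ∀ t, 0 ≤ t → x t = (∫ s in (0 : ℝ)..t, θ * (μ + x s)) + g t := by
    intro t ht
    have := hX.real_equation ω ht
    rw [h0, sub_zero] at this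
    rw [hx, hg]
    exact this
  have hK' : IntegrableOn (fun s => Real.exp (-(θ / 2) * s) * g s ^ 2) (Set.Ioi 0) := by
    rw [hg]; exact hK
  have hW' : W = μ + θ * ∫ s in Set.Ioi (0 : ℝ), Real.exp (-θ * s) * g s := by
    rw [hWdef, hg]; rfl
  have hT : Tendsto (fun n => (u n : ℝ)) atTop atTop := NNReal.tendsto_coe_atTop.2 hu
  have hgu : ∀ n, g (u n) = G (u n) ω := fun n => by simp [hg]
  have hxu : ∀ n, x (u n) = X (u n) ω := fun n => by simp [hx]
  have hξ : ∀ n, expNoise θ G (u n) ω = noisePath θ g (u n) := fun n => by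
    rw [hg]; exact expNoise_eq_noisePath θ hc h0 (u n)
  rw [← hWdef] at hW ⊢
  simp only [← hgu] at hGu
  have hpos : ∀ᶠ n in atTop, 0 < (u n : ℝ) := hT.eventually_gt_atTop 0
  have hJ := tendsto_renormalized_sub hθ hgc hxc heq hK' hW' (fun n => (u n).coe_nonneg) hT hGu
  -- By variation of constants the difference is (`discountedPath` − W) − μe^{-θT} + e^{-θT} g(T),
  -- and each part stays negligible after multiplication by T.
  have hXW : Tendsto (fun n => (u n : ℝ) * (Real.exp (-θ * u n) * x (u n) - W)) atTop (𝓝 0) := by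
    obtain ⟨C, hC, hWC⟩ := exists_abs_discountedPath_sub_le μ hθ hgc hK'
    rw [← hW'] at hWC
    have t1 : Tendsto (fun n => (u n : ℝ) * (discountedPath θ μ g (u n) - W)) atTop (𝓝 0) := by
      have t2 := (tendsto_exp_neg_mul_mul_rpow (half_pos hθ) 1 hT).const_mul C
      rw [mul_zero] at t2
      refine squeeze_zero_norm (fun n => ?_) t2
      rw [Real.norm_eq_abs, abs_mul, abs_of_nonneg (u n).coe_nonneg, Real.rpow_one]
      calc _ ≤ (u n : ℝ) * (C * Real.exp (-(θ / 2) * u n)) :=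
            mul_le_mul_of_nonneg_left (hWC _ (u n).coe_nonneg) (u n).coe_nonneg
        _ = _ := by ring
    have t3 := tendsto_exp_neg_mul_mul_rpow hθ 1 hT
    have t4 := (tendsto_exp_neg_mul_mul_rpow hθ 2 hT).mul hGu
    have t5 := (t1.sub (t3.const_mul μ)).add t4
    simp only [mul_zero, sub_zero, add_zero] at t5
    refine t5.congr' (hpos.mono fun n hn => ?_)
    dsimp only
    rw [solution_eq hgc hxc heq (u n).coe_nonneg, Real.rpow_one, Real.rpow_two]
    have e := exp_neg_mul_self θ (u n)
    have e' : (u n : ℝ) ^ 2 * (g (u n) / u n) = u n * g (u n) := by field_simp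
    linear_combination Real.exp (-θ * u n) * e' - u n * discountedPath θ μ g (u n) * e
  have hmain := tendsto_estimators_sub (μ := μ) (I₁ := fun n => ∫ s in (0 : ℝ)..u n, x s)
    (I₂ := fun n => ∫ s in (0 : ℝ)..u n, x s ^ 2) hθ hη hη1 hW hT
    (fun n => integral_solution hθ.ne' hxc heq (u n).coe_nonneg) hXW hJ hGu
    (by simpa only [← hξ] using hξu)
  simp only [hxu, hgu, ← hξ] at hmain
  rw [hx] at hmain
  exact hmain

variable [MeasurableSpace Ω] {P : Measure Ω} {l σ : ℝ}

theorem tendsto_integral_scaled_sq (hA2 : AssumptionA2 G P l η) :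
    Tendsto (fun T : ℝ≥0 => ∫ ω, (G T ω / (T : ℝ) ^ η) ^ 2 ∂P) atTop (𝓝 (l ^ 2)) := by
  refine hA2.2.2.2.congr fun T => ?_
  simp only [div_pow]
  rw [integral_div, ← Real.rpow_natCast, ← Real.rpow_mul T.coe_nonneg]
  congr 2
  push_cast
  ring

/-- Random variables that are independent of the process are independent of `ζ_∞`. -/
theorem indepFun_zetaInfty (hG : IsCenteredGaussian G P) (θ : ℝ) {E : Type*} [MeasurableSpace E]
    {N : Ω → E} (h : IndepFun N (fun ω (t : ℝ≥0) => G t ω) P) :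
    IndepFun N (zetaInfty θ G) P := by
  rw [IndepFun_iff_Indep] at h ⊢
  refine indep_of_indep_of_le_right h (Measurable.comap_le ?_)
  -- Measurability is taken with respect to the σ-algebra generated by the path of G, not the
  -- ambient one.
  refine @measurable_zetaInfty Ω
    (MeasurableSpace.comap (fun ω (t : ℝ≥0) => G t ω) MeasurableSpace.pi) G θ
    (fun t => ?_) hG.continuous
  exact (measurable_pi_apply (X := fun _ : ℝ≥0 => ℝ) t).comp (comap_measurable _)

variable [IsProbabilityMeasure P]

theorem tendsto_rpow_neg_coe {r : ℝ} (hr : 0 < r) :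
    Tendsto (fun T : ℝ≥0 => (T : ℝ) ^ (-r)) atTop (𝓝 0) :=
  (tendsto_rpow_neg_atTop hr).comp (NNReal.tendsto_coe_atTop.2 tendsto_id)

theorem IsCenteredGaussian.expNoise_memLp_two (hG : IsCenteredGaussian G P) (θ : ℝ) (T : ℝ≥0) :
    MemLp (expNoise θ G T) 2 P :=
  hG.isGaussianSpace.aeClosure.memLp_two (expNoise_mem_aeClosure θ hG.continuous T)

/-- The second moment is (E[G_T²]/T^{2η}) T^{-2(1−η)}, which vanishes as η < 1. -/
theorem tendstoInMeasure_div_time (hG : IsCenteredGaussian G P) (hA2 : AssumptionA2 G P l η) :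
    TendstoInMeasure P (fun (T : ℝ≥0) ω => G T ω / (T : ℝ)) atTop 0 := by
  obtain ⟨-, -, hη1, hlim⟩ := hA2
  refine tendstoInMeasure_of_tendsto_integral_sq (fun T => ?_) ?_
  · simpa only [div_eq_inv_mul] using (hG.memLp_two T).const_mul (T : ℝ)⁻¹
  · have h := hlim.mul (tendsto_rpow_neg_coe (r := 2 * (1 - η)) (by linarith))
    rw [mul_zero] at h
    refine h.congr' ((eventually_gt_atTop 0).mono fun T hT => ?_)
    have hT : 0 < (T : ℝ) := hT
    simp only [div_pow]
    rw [integral_div, div_mul_eq_mul_div, mul_div_assoc, ← Real.rpow_sub hT, div_eq_mul_inv]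
    congr 1
    rw [← Real.rpow_natCast, ← Real.rpow_neg hT.le]
    congr 1
    push_cast
    ring

theorem tendstoInMeasure_expNoise_div (hG : IsCenteredGaussian G P) (hη : 0 < η)
    (hA3 : AssumptionA3 θ G P σ) :
    TendstoInMeasure P (fun (T : ℝ≥0) ω => expNoise θ G T ω / (T : ℝ) ^ η) atTop 0 := by
  refine tendstoInMeasure_of_tendsto_integral_sq (fun T => ?_) ?_
  · simpa only [div_eq_inv_mul] using (hG.expNoise_memLp_two θ T).const_mul ((T : ℝ) ^ η)⁻¹
  · have h := hA3.2.mul ((tendsto_rpow_neg_coe hη).pow 2)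
    rw [zero_pow two_ne_zero, mul_zero] at h
    refine h.congr fun T => ?_
    simp only [div_pow]
    rw [integral_div, div_eq_mul_inv, Real.rpow_neg T.coe_nonneg, inv_pow]

/-- Variables asymptotically orthogonal to the process are asymptotically orthogonal to `ζ_∞`. -/
theorem tendsto_integral_zetaInfty_mul (hG : IsCenteredGaussian G P) (hθ : 0 < θ)
    (hA1 : AssumptionA1 G P) {A : ℝ≥0 → Ω → ℝ} (hA : ∀ T, MemLp (A T) 2 P) {C : ℝ}
    (hC : Tendsto (fun T => ∫ ω, A T ω ^ 2 ∂P) atTop (𝓝 C))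
    (h : ∀ s, Tendsto (fun T => ∫ ω, G s ω * A T ω ∂P) atTop (𝓝 0)) :
    Tendsto (fun T => ∫ ω, zetaInfty θ G ω * A T ω ∂P) atTop (𝓝 0) := by
  have hS := hG.isGaussianSpace
  have hb : ∀ᶠ T in atTop, ∫ ω, A T ω ^ 2 ∂P ≤ C + 1 :=
    hC.eventually_le_const (lt_add_one C)
  -- Orthogonality climbs from the G_s to their span and then through both closures, the second of
  -- which contains ζ_∞.
  refine hS.aeClosure.tendsto_integral_mul_aeClosure hA hb
    (hS.tendsto_integral_mul_aeClosure hA hb (tendsto_integral_mul_span hS hA h)) _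
    (zetaInfty_mem_aeClosure hG.continuous ?_)
  filter_upwards [ae_integrableOn_exp_mul_sq hθ hG hA1] with ω hω
  exact integrableOn_exp_mul hθ ((hG.continuous ω).comp continuous_real_toNNReal) hω

end Convergence

/-! ### Limit laws of the estimators -/

section Final

variable {Ω : Type*} [MeasurableSpace Ω] {P : Measure Ω}
  {θ μ l σ η : ℝ} {G X : ℝ≥0 → Ω → ℝ}

theorem IsSolution.aemeasurable_estimators (hX : IsSolution θ μ G X)
    (hG : IsCenteredGaussian G P) (T : ℝ≥0) :
    AEMeasurable (fun ω => thetaTilde (fun s => X s ω) T) P ∧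
    AEMeasurable (fun ω => muTilde (fun s => X s ω) T) P ∧
    AEMeasurable (fun ω => alphaTilde (fun s => X s ω) T) P := by
  have hm := hX.measurable hG.measurable hG.continuous
  have h0 := hm T
  have h1 := measurable_timeIntegral hm hX.continuous T
  have h2 := measurable_timeIntegral_pow hm hX.continuous 2 T
  unfold thetaTilde muTilde alphaTilde
  refine ⟨Measurable.aemeasurable ?_, Measurable.aemeasurable ?_, Measurable.aemeasurable ?_⟩ <;>
    fun_prop

variable [IsProbabilityMeasure P]

/-- A reduction of the limit theorems for the estimators to limit theorems for their leading
terms. -/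
theorem IsSolution.tendstoInDistribution_estimators (hX : IsSolution θ μ G X) (hθ : 0 < θ)
    (hG : IsCenteredGaussian G P) (hA1 : AssumptionA1 G P) (hA2 : AssumptionA2 G P l η)
    (hA3 : AssumptionA3 θ G P σ) (hne : ∀ᵐ ω ∂P, μ + zetaInfty θ G ω ≠ 0)
    {E : Type*} [NormedAddCommGroup E] [NormedSpace ℝ E] [SecondCountableTopology E]
    [MeasurableSpace E] [BorelSpace E] (L : ℝ × ℝ × ℝ →L[ℝ] E) {Z : Ω → E}
    (hZ : TendstoInDistribution (fun (T : ℝ≥0) ω =>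
      L (2 * θ * expNoise θ G T ω / (μ + zetaInfty θ G ω), G T ω / (T : ℝ) ^ η / θ,
        G T ω / (T : ℝ) ^ η)) atTop Z (fun _ => P) P) :
    TendstoInDistribution (fun (T : ℝ≥0) ω =>
      L (Real.exp (θ * T) * (thetaTilde (fun s => X s ω) T - θ),
        (T : ℝ) ^ (1 - η) * (muTilde (fun s => X s ω) T - μ),
        (T : ℝ) ^ (1 - η) * (alphaTilde (fun s => X s ω) T - θ * μ))) atTop Z (fun _ => P) P := by
  have hmeas : ∀ T : ℝ≥0, AEMeasurable (fun ω =>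
      L (Real.exp (θ * T) * (thetaTilde (fun s => X s ω) T - θ),
        (T : ℝ) ^ (1 - η) * (muTilde (fun s => X s ω) T - μ),
        (T : ℝ) ^ (1 - η) * (alphaTilde (fun s => X s ω) T - θ * μ))) P := by
    intro T
    obtain ⟨h1, h2, h3⟩ := hX.aemeasurable_estimators hG T
    refine L.continuous.measurable.comp_aemeasurable ?_
    exact ((h1.sub_const θ).const_mul _).prodMk
      (((h2.sub_const μ).const_mul _).prodMk ((h3.sub_const (θ * μ)).const_mul _))
  -- Slutsky's lemma. The linear map `L` selects coordinates, so that marginal and joint limits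
  -- share one argument.
  refine tendstoInDistribution_of_tendstoInMeasure_sub _ Z hZ ?_ hmeas
  refine tendstoInMeasure_of_ae_tendsto_seq (tendstoInMeasure_div_time hG hA2)
    (tendstoInMeasure_expNoise_div hG hA2.2.1 hA3)
    (fun T => ((hmeas T).sub (hZ.forall_aemeasurable T)).aestronglyMeasurable) ?_
  filter_upwards [hA1.1, ae_integrableOn_exp_mul_sq hθ hG hA1, hne] with ω h0 hK hW u hu hR₁ hR₂
  obtain ⟨t1, t2, t3⟩ := hX.tendsto_estimators hθ hA2.2.1 hA2.2.2.1 (hG.continuous ω) h0 hK hW hu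
    hR₁ hR₂
  have h := (L.continuous.tendsto _).comp (t1.prodMk_nhds (t2.prodMk_nhds t3))
  have hz : L (0, 0, 0) = 0 := L.map_zero
  rw [hz] at h
  refine h.congr fun n => ?_
  simp only [Function.comp_apply, Pi.sub_apply, ← map_sub, Prod.mk_sub_mk]

/-- Joint convergence of the leading terms of the estimation errors. -/
theorem tendstoInDistribution_leading (hG : IsCenteredGaussian G P) (hθ : 0 < θ)
    (hA1 : AssumptionA1 G P) (hne : ∀ᵐ ω ∂P, μ + zetaInfty θ G ω ≠ 0)
    (hA3 : AssumptionA3 θ G P σ) (hA4 : AssumptionA4 θ G P)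
    {B : ℝ≥0 → Ω → ℝ} {b : ℝ} (hB : ∀ T, B T ∈ Submodule.span ℝ (Set.range G))
    (hBB : Tendsto (fun T => ∫ ω, B T ω ^ 2 ∂P) atTop (𝓝 (b ^ 2)))
    (hBξ : Tendsto (fun T => ∫ ω, B T ω * expNoise θ G T ω ∂P) atTop (𝓝 0))
    (hBG : ∀ s, Tendsto (fun T => ∫ ω, G s ω * B T ω ∂P) atTop (𝓝 0))
    {N₁ N₂ : Ω → ℝ} (hN₁ : HasLaw N₁ (gaussianReal 0 1) P) (hN₂ : HasLaw N₂ (gaussianReal 0 1) P)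
    (hN : IndepFun N₁ N₂ P)
    (hNG : IndepFun (fun ω => (N₁ ω, N₂ ω)) (fun ω (t : ℝ≥0) => G t ω) P) :
    TendstoInDistribution
      (fun T ω => (2 * θ * expNoise θ G T ω / (μ + zetaInfty θ G ω), B T ω)) atTop
      (fun ω => (2 * θ * σ * N₂ ω / (μ + zetaInfty θ G ω), b * N₁ ω)) (fun _ => P) P := by
  have hS := hG.isGaussianSpace
  have hle := le_aeClosure (Submodule.span ℝ (Set.range G)) P
  have hle' := le_aeClosure (aeClosure (Submodule.span ℝ (Set.range G)) P) P
  have hint : ∀ᵐ ω ∂P, IntegrableOn (fun s => Real.exp (-θ * s) * G s.toNNReal ω)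
      (Set.Ioi 0) := by
    filter_upwards [ae_integrableOn_exp_mul_sq hθ hG hA1] with ω hω
    exact integrableOn_exp_mul hθ ((hG.continuous ω).comp continuous_real_toNNReal) hω
  have h := hS.aeClosure.aeClosure.tendstoInDistribution_triple
    (fun T => hle' (expNoise_mem_aeClosure θ hG.continuous T)) (fun T => hle' (hle (hB T)))
    (zetaInfty_mem_aeClosure hG.continuous hint) hA3.2 hBB
    (by simpa only [mul_comm] using hBξ)
    (tendsto_integral_zetaInfty_mul hG hθ hA1 (hG.expNoise_memLp_two θ) hA3.2 hA4)
    (tendsto_integral_zetaInfty_mul hG hθ hA1 (fun T => hS.memLp_two (hB T)) hBB hBG)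
    hN₁ hN₂ hN (indepFun_zetaInfty hG θ hNG)
  -- The quotient map is continuous wherever μ + ζ_∞ ≠ 0, hence at almost every value of the limit.
  have h2 := tendstoInDistribution_comp_of_ae_continuousAt
    (g := fun p : ℝ × ℝ × ℝ => (2 * θ * p.1 / (μ + p.2.2), p.2.1)) (by fun_prop) ?_ h
  · refine h2.congr (fun _ => ae_eq_rfl) (ae_of_all _ fun ω => ?_)
    simp only [mul_assoc]
  · filter_upwards [hne] with ω hω
    refine ContinuousAt.prodMk (ContinuousAt.div (by fun_prop) (by fun_prop) hω) (by fun_prop)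

theorem scaled_mem_span {Ω : Type*} {G : ℝ≥0 → Ω → ℝ} (η : ℝ) (T : ℝ≥0) :
    (fun ω => G T ω / (T : ℝ) ^ η) ∈ Submodule.span ℝ (Set.range G) := by
  have h := Submodule.smul_mem (Submodule.span ℝ (Set.range G)) ((T : ℝ) ^ η)⁻¹
    (Submodule.subset_span ⟨T, rfl⟩)
  convert h using 1
  ext ω
  simp [div_eq_inv_mul]

/-- The rescaled process converges in law to a Gaussian variable. -/
theorem tendstoInDistribution_scaled (hG : IsCenteredGaussian G P) (hA2 : AssumptionA2 G P l η)
    {N₁ N₂ : Ω → ℝ} (hN₁ : HasLaw N₁ (gaussianReal 0 1) P) (hN₂ : HasLaw N₂ (gaussianReal 0 1) P)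
    (hN : IndepFun N₁ N₂ P) :
    TendstoInDistribution (fun (T : ℝ≥0) ω => G T ω / (T : ℝ) ^ η) atTop (fun ω => l * N₁ ω)
      (fun _ => P) P := by
  have hS := hG.isGaussianSpace
  -- With A and H zero the covariance conditions are trivial, and only the variance limit of G_T/T^η
  -- enters.
  have h := hS.tendstoInDistribution_triple (l := atTop) (A := fun _ : ℝ≥0 => 0)
    (B := fun (T : ℝ≥0) ω => G T ω / (T : ℝ) ^ η) (H := 0) (a₀ := 0) (fun _ => Submodule.zero_mem _)
    (fun T => scaled_mem_span η T) (Submodule.zero_mem _)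
    (by simp) (tendsto_integral_scaled_sq hA2)
    (by simp) (by simp)
    (by simp) hN₁ hN₂ hN (indepFun_const_right _ (0 : ℝ))
  exact h.continuous_comp (g := fun p : ℝ × ℝ × ℝ => p.2.1) (by fun_prop)

end Final

end Vasicek

theorem mainTheorem2 {Ω : Type*} [MeasurableSpace Ω] (P : Measure Ω) [IsProbabilityMeasure P]
    (θ μ lG σG η : ℝ) (hθ : 0 < θ)
    (G X : ℝ≥0 → Ω → ℝ) (hG : Vasicek.IsCenteredGaussian G P)
    (hX : Vasicek.IsSolution θ μ G X)
    (hA1 : Vasicek.AssumptionA1 G P) (hA2 : Vasicek.AssumptionA2 G P lG η)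
    (hA3 : Vasicek.AssumptionA3 θ G P σG) (hA4 : Vasicek.AssumptionA4 θ G P)
    (hne : ∀ᵐ ω ∂P, μ + Vasicek.zetaInfty θ G ω ≠ 0)
    (N₁ N₂ : Ω → ℝ) (hN₁ : HasLaw N₁ (gaussianReal 0 1) P) (hN₂ : HasLaw N₂ (gaussianReal 0 1) P)
    (hN : IndepFun N₁ N₂ P)
    (hNG : IndepFun (fun ω => (N₁ ω, N₂ ω)) (fun ω (t : ℝ≥0) => G t ω) P) :
    TendstoInDistribution
        (fun (T : ℝ≥0) ω => Real.exp (θ * T) * (Vasicek.thetaTilde (fun s => X s ω) T - θ))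
        atTop (fun ω => 2 * θ * σG * N₂ ω / (μ + Vasicek.zetaInfty θ G ω)) (fun _ => P) P ∧
    TendstoInDistribution
        (fun (T : ℝ≥0) ω => (T : ℝ) ^ (1 - η) * (Vasicek.muTilde (fun s => X s ω) T - μ))
        atTop (fun ω => lG / θ * N₁ ω) (fun _ => P) P ∧
    TendstoInDistribution
        (fun (T : ℝ≥0) ω => (T : ℝ) ^ (1 - η) * (Vasicek.alphaTilde (fun s => X s ω) T - θ * μ))
        atTop (fun ω => lG * N₁ ω) (fun _ => P) P ∧
    (Vasicek.AssumptionA5 θ G P η →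
      TendstoInDistribution
          (fun (T : ℝ≥0) ω =>
            (Real.exp (θ * T) * (Vasicek.thetaTilde (fun s => X s ω) T - θ),
              (T : ℝ) ^ (1 - η) * (Vasicek.muTilde (fun s => X s ω) T - μ)))
          atTop
          (fun ω => (2 * θ * σG * N₂ ω / (μ + Vasicek.zetaInfty θ G ω), lG / θ * N₁ ω))
          (fun _ => P) P ∧
      TendstoInDistribution
          (fun (T : ℝ≥0) ω =>
            (Real.exp (θ * T) * (Vasicek.thetaTilde (fun s => X s ω) T - θ),
              (T : ℝ) ^ (1 - η) * (Vasicek.alphaTilde (fun s => X s ω) T - θ * μ)))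
          atTop
          (fun ω => (2 * θ * σG * N₂ ω / (μ + Vasicek.zetaInfty θ G ω), lG * N₁ ω))
          (fun _ => P) P) := by
  have hscaled := Vasicek.tendstoInDistribution_scaled hG hA2 hN₁ hN₂ hN
  have hsdiv := hscaled.continuous_comp (g := fun y => y / θ) (by fun_prop)
  let p₁ := ContinuousLinearMap.fst ℝ ℝ (ℝ × ℝ)
  let p₂ := (ContinuousLinearMap.fst ℝ ℝ ℝ).comp (ContinuousLinearMap.snd ℝ ℝ (ℝ × ℝ))
  let p₃ := (ContinuousLinearMap.snd ℝ ℝ ℝ).comp (ContinuousLinearMap.snd ℝ ℝ (ℝ × ℝ))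
  refine ⟨hX.tendstoInDistribution_estimators hθ hG hA1 hA2 hA3 hne p₁ ?_,
    hX.tendstoInDistribution_estimators hθ hG hA1 hA2 hA3 hne p₂ ?_,
    hX.tendstoInDistribution_estimators hθ hG hA1 hA2 hA3 hne p₃ hscaled, fun hA5 => ?_⟩
  -- Taking B = 0 makes its covariance conditions trivial, so the marginal limit for θ̃ needs no
  -- `AssumptionA5`.
  · have h := Vasicek.tendstoInDistribution_leading (μ := μ) hG hθ hA1 hne hA3 hA4
      (B := fun _ => 0) (b := 0) (fun _ => Submodule.zero_mem _)
      (by simp) (by simp)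
      (fun _ => by simp) hN₁ hN₂ hN hNG
    exact h.continuous_comp (g := Prod.fst) continuous_fst
  · refine hsdiv.congr (fun _ => ae_eq_rfl) (ae_of_all _ fun ω => ?_)
    simp only [Function.comp_apply]
    ring
  -- Here B = G_T/T^η, and `AssumptionA5` supplies exactly its asymptotic orthogonality to ξ_T and
  -- to each G_s.
  · have h := Vasicek.tendstoInDistribution_leading (μ := μ) hG hθ hA1 hne hA3 hA4
      (fun T => Vasicek.scaled_mem_span η T) (Vasicek.tendsto_integral_scaled_sq hA2) hA5.2
      (fun s => (hA5.1 s).congr fun T => by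
        rw [← integral_div]; simp only [mul_div_assoc]) hN₁ hN₂ hN hNG
    refine ⟨hX.tendstoInDistribution_estimators hθ hG hA1 hA2 hA3 hne (p₁.prod p₂) ?_,
      hX.tendstoInDistribution_estimators hθ hG hA1 hA2 hA3 hne (p₁.prod p₃) h⟩
    refine (h.continuous_comp (g := fun p : ℝ × ℝ => (p.1, p.2 / θ)) (by fun_prop)).congr
      (fun _ => ae_eq_rfl) (ae_of_all _ fun ω => ?_)
    simp only [Function.comp_apply, Prod.mk.injEq, true_and]
    ring
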